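/- Let $\lambda_1,\lambda_2>0$, let $F:\mathbb R^2\to\mathbb R^2$ be bounded and Lipschitz, and let $(z(t))_{t\ge 0}$ be a one-dimensional Lévy process (started at $0$, with independent and stationary increments and almost surely càdlàg paths) on a probability space $(\Omega,\mathcal A,\mathbb P)$. Put $A=\mathrm{diag}(-\lambda_1,-\lambda_2)$ and $Z_t=(z(t),0)^T$, and let $\mathcal F_t$ be the $\sigma$-algebra generated by $z(s)$, $s\le t$, and the $\mathbb P$-null sets of $\mathcal A$. For $x\in\mathbb R^2$ consider the equation $$dX(t)=[AX(t)+F(X(t))]\,dt+dZ_t,\qquad X(0)=x. \tag{1.1}$$ A solution is a jointly measurable process $X:[0,\infty)\times\Omega\to\mathbb R^2$ such that for every $t\ge0$, almost surely, $s\mapsto AX(s)+F(X(s))$ is integrable on $[0,t]$ and $X(t)=x+\int_0^t[AX(s)+F(X(s))]\,ds+Z_t$; it is a strong solution if moreover $X(t)$ is $\mathcal F_t$-measurable for every $t$. Theorem. For every $x\in\mathbb R^2$: (i) Equation (1.1) has a strong solution $(X^x(t))_{t\ge0}$. It is unique: any two solutions $X,Y$ (adapted or not) satisfy $\mathbb P(X(t)=Y(t))=1$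 for every $t\ge 0$. (ii) A jointly measurable process $X$ is a solution if and only if for every $t\ge0$, almost surely, $$X(t)=e^{At}x+\int_0^te^{A(t-s)}F(X(s))\,ds+\int_0^te^{A(t-s)}\,dZ_s, \tag{2.3}$$ where the last integral is the limit in probability of the left-point Riemann sums $\sum_i e^{A(t-t_i)}(Z_{t_{i+1}}-Z_{t_i})$ along partitions of $[0,t]$ with mesh tending to zero (and this limit exists). In particular the strong solution is given by (2.3). (iii) The strong solution $X^x$ has a version that is again a strong solution, all of whose paths are càdlàg in $\mathbb R^2$ and which almost surely satisfies the integrated equation simultaneously for all $t\ge0$. (iv) $X^x$ is an $\mathbb R^2$-valued time-homogeneous Markov process starting from $x$: there are Markov kernels $(\kappa_t)_{t\ge0}$ on $\mathbb R^2$, not depending on $x$, with $\kappa_0(y,\cdot)=\delta_y$ and $\kappa_{s+t}(y,B)=\int\kappa_t(y',B)\,\kappa_s(y,dy')$, such that $X^x(0)=x$ almost surely, $X^x(t)$ has law $\kappa_t(x,\cdot)$, and $\mathbb P(X^x(s+t)\in B\mid\mathcal F_s)=\kappa_t(X^x(s),B)$ almost surely for all $s,t\ge0$ and all Borel sets $B\subseteq\mathbb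 R^2$. -/

import Mathlib

open MeasureTheory ProbabilityTheory Filter Topology
open scoped NNReal ENNReal

noncomputable section

namespace LevySDE

/-- The Euclidean plane `ℝ²`. -/
abbrev Plane : Type := EuclideanSpace ℝ (Fin 2)

/-- A path `[0, ∞) → E` is càdlàg: right-continuous with left limits. -/
def IsCadlag {E : Type*} [TopologicalSpace E] (f : ℝ≥0 → E) : Prop :=
  ∀ t : ℝ≥0, ContinuousWithinAt f (Set.Ici t) t ∧ ∃ l : E, Tendsto f (𝓝[<] t) (𝓝 l)

/-- A one-dimensional Lévy process: it starts from `0`, has independent and stationary increments,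
and its paths are almost surely càdlàg. -/
structure IsLevyProcess {Ω : Type*} [MeasurableSpace Ω] (P : Measure Ω) (z : ℝ≥0 → Ω → ℝ) :
    Prop where
  measurable : ∀ t, Measurable (z t)
  zero : ∀ᵐ ω ∂P, z 0 ω = 0
  indep : HasIndepIncrements z P
  stationary : ∀ s t : ℝ≥0, IdentDistrib (fun ω ↦ z (s + t) ω - z s ω) (z t) P P
  cadlag : ∀ᵐ ω ∂P, IsCadlag (fun t ↦ z t ω)

/-- The linear drift `A = diag(-l₁, -l₂)`. -/
def linDrift (l₁ l₂ : ℝ) : Plane →L[ℝ] Plane :=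
  Matrix.toEuclideanCLM (n := Fin 2) (𝕜 := ℝ) (Matrix.diagonal ![-l₁, -l₂])

/-- The matrix exponential `e^{rA}`, `A = diag(-l₁, -l₂)`. -/
def expDrift (l₁ l₂ r : ℝ) : Plane →L[ℝ] Plane :=
  NormedSpace.exp (r • linDrift l₁ l₂)

/-- The degenerate planar noise `Z_t = (z(t), 0)`. -/
def noise {Ω : Type*} (z : ℝ≥0 → Ω → ℝ) (t : ℝ≥0) (ω : Ω) : Plane :=
  !₂[z t ω, 0]

/-- `I` is the stochastic integral `∫_0^t Φ(s) dZ_s` of the deterministic operator-valued function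
`Φ` against the process `Z`: along every sequence of partitions
`0 = τ k 0 ≤ τ k 1 ≤ ... ≤ τ k (N k) = t` whose mesh tends to zero, the left-point Riemann sums
`∑ i, Φ(τ k i) (Z_{τ k (i+1)} - Z_{τ k i})` converge to `I` in probability. -/
def IsStochIntegral {Ω : Type*} [MeasurableSpace Ω] (P : Measure Ω)
    (Φ : ℝ≥0 → Plane →L[ℝ] Plane) (Z : ℝ≥0 → Ω → Plane) (t : ℝ≥0) (I : Ω → Plane) : Prop :=
  ∀ (N : ℕ → ℕ) (τ : ℕ → ℕ → ℝ≥0),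
    (∀ k, Monotone (τ k)) → (∀ k, τ k 0 = 0) → (∀ k, τ k (N k) = t) →
    (∀ δ : ℝ≥0, 0 < δ → ∀ᶠ k in atTop, ∀ i < N k, τ k (i + 1) < τ k i + δ) →
    TendstoInMeasure P
      (fun k ω ↦ ∑ i ∈ Finset.range (N k), Φ (τ k i) (Z (τ k (i + 1)) ω - Z (τ k i) ω))
      atTop I

/-- The constant filtration generated by the (measurable) `P`-null sets. -/
def nullFiltration {Ω : Type*} [mΩ : MeasurableSpace Ω] (P : Measure Ω) : Filtration ℝ≥0 mΩ where
  seq _ := MeasurableSpace.generateFrom {N : Set Ω | MeasurableSet N ∧ P N = 0}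
  mono' _ _ _ := le_rfl
  le' _ := MeasurableSpace.generateFrom_le fun _ h ↦ h.1

/-- The augmented filtration of the noise: at time `t` it is generated by `z(s)`, `s ≤ t`, and the
`P`-null sets. -/
def noiseFiltration {Ω : Type*} [mΩ : MeasurableSpace Ω] {P : Measure Ω} {z : ℝ≥0 → Ω → ℝ}
    (hz : IsLevyProcess P z) : Filtration ℝ≥0 mΩ :=
  Filtration.natural z (fun t ↦ (hz.measurable t).stronglyMeasurable) ⊔ nullFiltration P

/-- The equation `X(t) = x + ∫_0^t (A X(s) + F(X(s))) ds + Z_t` at time `t` for the sample point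
`ω`, the integrand being integrable on `[0, t]`. -/
def SolvesAt {Ω : Type*} (z : ℝ≥0 → Ω → ℝ) (l₁ l₂ : ℝ) (F : Plane → Plane) (x : Plane)
    (X : ℝ≥0 → Ω → Plane) (t : ℝ≥0) (ω : Ω) : Prop :=
  IntervalIntegrable
      (fun s : ℝ ↦ linDrift l₁ l₂ (X s.toNNReal ω) + F (X s.toNNReal ω)) volume 0 t ∧
    X t ω = x + (∫ s in (0 : ℝ)..t, (linDrift l₁ l₂ (X s.toNNReal ω) + F (X s.toNNReal ω)))
      + noise z t ω

/-- A jointly measurable process `X` that solves `dX = (A X + F(X)) dt + dZ`, `X(0) = x`: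
the integrated equation holds almost surely at every time. No adaptedness is required. -/
structure IsSolution {Ω : Type*} [MeasurableSpace Ω] (P : Measure Ω) (z : ℝ≥0 → Ω → ℝ)
    (l₁ l₂ : ℝ) (F : Plane → Plane) (x : Plane) (X : ℝ≥0 → Ω → Plane) : Prop where
  measurable : Measurable (Function.uncurry X)
  solves : ∀ t : ℝ≥0, ∀ᵐ ω ∂P, SolvesAt z l₁ l₂ F x X t ω

/-- A strong solution: a solution on the given probability space that is adapted to the augmented
filtration of the driving noise. -/
structure IsStrongSolution {Ω : Type*} [MeasurableSpace Ω] {P : Measure Ω} {z : ℝ≥0 → Ω → ℝ}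
    (hz : IsLevyProcess P z) (l₁ l₂ : ℝ) (F : Plane → Plane) (x : Plane)
    (X : ℝ≥0 → Ω → Plane) : Prop extends IsSolution P z l₁ l₂ F x X where
  adapted : Adapted (noiseFiltration hz) X

/-- A jointly measurable process `X` that satisfies the mild formula
`X(t) = e^{At} x + ∫_0^t e^{A(t-s)} F(X(s)) ds + ∫_0^t e^{A(t-s)} dZ_s`
almost surely at every time. -/
structure IsMildSolution {Ω : Type*} [MeasurableSpace Ω] (P : Measure Ω) (z : ℝ≥0 → Ω → ℝ)
    (l₁ l₂ : ℝ) (F : Plane → Plane) (x : Plane) (X : ℝ≥0 → Ω → Plane) : Prop where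
  measurable : Measurable (Function.uncurry X)
  mild : ∀ t : ℝ≥0, ∃ I : Ω → Plane,
    IsStochIntegral P (fun s ↦ expDrift l₁ l₂ ((t : ℝ) - s)) (noise z) t I ∧
    ∀ᵐ ω ∂P,
      IntervalIntegrable
        (fun s : ℝ ↦ expDrift l₁ l₂ ((t : ℝ) - s) (F (X s.toNNReal ω))) volume 0 t ∧
      X t ω = expDrift l₁ l₂ t x
        + (∫ s in (0 : ℝ)..t, expDrift l₁ l₂ ((t : ℝ) - s) (F (X s.toNNReal ω))) + I ω

/-- `Y` is a version (modification) of `X`. -/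
def IsVersion {Ω : Type*} [MeasurableSpace Ω] (P : Measure Ω) (X Y : ℝ≥0 → Ω → Plane) : Prop :=
  ∀ t, ∀ᵐ ω ∂P, X t ω = Y t ω

/-- A (conservative, time-homogeneous) transition semigroup on `ℝ²`: Markov kernels satisfying the
Chapman-Kolmogorov equations. -/
structure IsTransitionSemigroup (κ : ℝ≥0 → Kernel Plane Plane) : Prop where
  markov : ∀ t, IsMarkovKernel (κ t)
  zero : κ 0 = Kernel.id
  add : ∀ s t, κ (s + t) = κ t ∘ₖ κ s

/-- `X` is a time-homogeneous Markov process with respect to the filtration `𝓕`, with transition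
probabilities `κ`, starting from `x`. -/
structure IsMarkovProcess {Ω : Type*} [mΩ : MeasurableSpace Ω] (P : Measure Ω)
    (𝓕 : Filtration ℝ≥0 mΩ) (κ : ℝ≥0 → Kernel Plane Plane) (x : Plane)
    (X : ℝ≥0 → Ω → Plane) : Prop where
  adapted : Adapted 𝓕 X
  start : ∀ᵐ ω ∂P, X 0 ω = x
  markov : ∀ (s t : ℝ≥0) (B : Set Plane), MeasurableSet B →
    P[(X (s + t) ⁻¹' B).indicator (fun _ ↦ (1 : ℝ)) | 𝓕 s] =ᵐ[P] fun ω ↦ (κ t (X s ω)).real B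

end LevySDE

end

/-! The noise is additive, so `V = X - Z` turns the equation into an ordinary integral equation
`V(t) = x + ∫_0^t b(V + w)` for each sample point, with `b(y) = A y + F y` Lipschitz and `w` a
càdlàg path. Only right continuity and local boundedness of `w` are needed (`IsRegularPath`). Picard
iteration gives a solution (`exists_isIntegralSol`). An Euler scheme converges to every solution
(`IsIntegralSol.tendsto_eulerScheme`); this yields uniqueness and also exhibits the solution as a
limit of functions of finitely many values of `w` up to time `t`. That limit is `flow`, so
adaptedness and joint measurability come without any measurable selection.

A solution in the sense of the theorem satisfies its equation only almost surely at each fixed time.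
Replacing it by the right-hand side of its own equation gives a version whose `V`-part is
continuous. By Fubini both agree at almost every time, so the continuous part solves the pathwise
equation and the process is a version of the canonical solution. The same argument treats mild
solutions, through variation of constants for `V` (`integral_eq_iff_mild`) and summation by parts
(`tendsto_sum_clm_apply_sub`), which evaluates the stochastic convolution pathwise.

The Markov property combines the flow identity `flow_add` with two facts about the increments after
time `s`: they are independent of the augmented past (`indep_noiseFiltration`) and have the law of
the whole noise (`map_increments`). -/

noncomputable section

namespace LevySDE

/-! ### Right-continuous, locally bounded paths -/

section Paths

variable {E : Type*} [NormedAddCommGroup E]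

/-- A path on the real line that is right-continuous and locally bounded. -/
structure IsRegularPath (w : ℝ → E) : Prop where
  rightCts : ∀ s, ContinuousWithinAt w (Set.Ici s) s
  bounded : ∀ a b, ∃ M, ∀ s ∈ Set.Icc a b, ‖w s‖ ≤ M

/-- A family of right-continuous paths that is measurable at each time is jointly measurable. -/
lemma measurable_uncurry_of_rightCts {α β : Type*} [MeasurableSpace α] [TopologicalSpace β]
    [TopologicalSpace.PseudoMetrizableSpace β] [MeasurableSpace β] [BorelSpace β]
    {f : ℝ → α → β} (hm : ∀ s, Measurable (f s))
    (hc : ∀ a s, ContinuousWithinAt (fun s ↦ f s a) (Set.Ici s) s) :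
    Measurable (Function.uncurry f) := by
  -- Round `s` up to the grid of mesh `1/(n+1)`: the rounded time takes countably many values and
  -- tends to `s` from the right.
  refine measurable_of_tendsto_metrizable
    (f := fun (n : ℕ) (p : ℝ × α) ↦ f ((⌈((n : ℝ) + 1) * p.1⌉ : ℝ) / (n + 1)) p.2) (fun n ↦ ?_) ?_
  · have h1 : Measurable (fun q : ℤ × α ↦ f ((q.1 : ℝ) / (n + 1)) q.2) :=
      measurable_from_prod_countable_right fun k ↦ hm ((k : ℝ) / (n + 1))
    exact h1.comp (((measurable_const.mul measurable_fst).ceil).prodMk measurable_snd)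
  · rw [tendsto_pi_nhds]
    rintro ⟨s, a⟩
    refine (hc a s).tendsto.comp (tendsto_nhdsWithin_iff.2 ⟨?_, Eventually.of_forall fun n ↦ ?_⟩)
    · have h0 : Tendsto (fun n : ℕ ↦ s + 1 / ((n : ℝ) + 1)) atTop (𝓝 s) := by
        simpa using (tendsto_const_nhds (x := s)).add
          (tendsto_one_div_add_atTop_nhds_zero_nat (𝕜 := ℝ))
      refine tendsto_of_tendsto_of_tendsto_of_le_of_le tendsto_const_nhds h0 (fun n ↦ ?_)
        (fun n ↦ ?_)
      · have hn : (0 : ℝ) < n + 1 := by positivity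
        simp only
        rw [le_div_iff₀ hn, mul_comm]
        exact Int.le_ceil _
      · have hn : (0 : ℝ) < n + 1 := by positivity
        simp only
        rw [div_le_iff₀ hn, add_mul s, one_div, inv_mul_cancel₀ hn.ne', mul_comm s]
        exact (Int.ceil_lt_add_one _).le
    · have hn : (0 : ℝ) < n + 1 := by positivity
      simp only [Set.mem_Ici]
      rw [le_div_iff₀ hn, mul_comm]
      exact Int.le_ceil _

lemma bounded_of_continuous {f : ℝ → E} (hf : Continuous f) (a b : ℝ) :
    ∃ M, ∀ s ∈ Set.Icc a b, ‖f s‖ ≤ M :=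
  isCompact_Icc.exists_bound_of_continuousOn hf.continuousOn

lemma IsRegularPath.of_continuous {f : ℝ → E} (hf : Continuous f) : IsRegularPath f :=
  ⟨fun _ ↦ hf.continuousWithinAt, bounded_of_continuous hf⟩

lemma IsRegularPath.add {f g : ℝ → E} (hf : IsRegularPath f) (hg : IsRegularPath g) :
    IsRegularPath (fun s ↦ f s + g s) := by
  refine ⟨fun s ↦ (hf.rightCts s).add (hg.rightCts s), fun a b ↦ ?_⟩
  obtain ⟨M, hM⟩ := hf.bounded a b
  obtain ⟨N, hN⟩ := hg.bounded a b
  exact ⟨M + N, fun s hs ↦ (norm_add_le _ _).trans (add_le_add (hM s hs) (hN s hs))⟩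

lemma IsRegularPath.sub {f g : ℝ → E} (hf : IsRegularPath f) (hg : IsRegularPath g) :
    IsRegularPath (fun s ↦ f s - g s) := by
  refine ⟨fun s ↦ (hf.rightCts s).sub (hg.rightCts s), fun a b ↦ ?_⟩
  obtain ⟨M, hM⟩ := hf.bounded a b
  obtain ⟨N, hN⟩ := hg.bounded a b
  exact ⟨M + N, fun s hs ↦ (norm_sub_le _ _).trans (add_le_add (hM s hs) (hN s hs))⟩

lemma IsRegularPath.norm {f : ℝ → E} (hf : IsRegularPath f) :
    IsRegularPath (fun s ↦ ‖f s‖) := by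
  refine ⟨fun s ↦ (hf.rightCts s).norm, fun a b ↦ ?_⟩
  obtain ⟨M, hM⟩ := hf.bounded a b
  exact ⟨M, fun s hs ↦ by simpa using hM s hs⟩

lemma IsRegularPath.lipschitz_comp {F : Type*} [NormedAddCommGroup F] {f : ℝ → E}
    (hf : IsRegularPath f) {b : E → F} {K : ℝ≥0} (hb : LipschitzWith K b) :
    IsRegularPath (fun s ↦ b (f s)) := by
  refine ⟨fun s ↦ hb.continuous.continuousAt.comp_continuousWithinAt (hf.rightCts s),
    fun c d ↦ ?_⟩
  obtain ⟨M, hM⟩ := hf.bounded c d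
  refine ⟨‖b 0‖ + K * M, fun s hs ↦ ?_⟩
  have h1 : ‖b (f s) - b 0‖ ≤ K * ‖f s - 0‖ := hb.norm_sub_le _ _
  have h2 : ‖b (f s)‖ ≤ ‖b 0‖ + ‖b (f s) - b 0‖ := by
    simpa using norm_add_le (b 0) (b (f s) - b 0)
  rw [sub_zero] at h1
  have h3 : (K : ℝ) * ‖f s‖ ≤ K * M := mul_le_mul_of_nonneg_left (hM s hs) K.2
  linarith

lemma IsRegularPath.clm_apply [NormedSpace ℝ E] {f : ℝ → E} (hf : IsRegularPath f)
    {Φ : ℝ → E →L[ℝ] E} (hΦ : Continuous Φ) : IsRegularPath (fun s ↦ Φ s (f s)) := by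
  refine ⟨fun s ↦ hΦ.continuousWithinAt.clm_apply (hf.rightCts s), fun a b ↦ ?_⟩
  obtain ⟨M, hM⟩ := hf.bounded a b
  obtain ⟨N, hN⟩ := bounded_of_continuous hΦ a b
  refine ⟨N * M, fun s hs ↦ ((Φ s).le_opNorm _).trans ?_⟩
  exact mul_le_mul (hN s hs) (hM s hs) (norm_nonneg _) ((norm_nonneg _).trans (hN s hs))

variable [MeasurableSpace E] [BorelSpace E]

lemma IsRegularPath.measurable {w : ℝ → E} (hw : IsRegularPath w) : Measurable w := by
  have := measurable_uncurry_of_rightCts (f := fun s (_ : Unit) ↦ w s)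
    (fun _ ↦ measurable_const) (fun _ s ↦ hw.rightCts s)
  exact this.comp (measurable_id.prodMk (measurable_const (a := ())))

variable [SecondCountableTopology E]

lemma IsRegularPath.intervalIntegrable {w : ℝ → E} (hw : IsRegularPath w) (a b : ℝ) :
    IntervalIntegrable w volume a b := by
  have key : ∀ a b : ℝ, IntegrableOn w (Set.Ioc a b) volume := fun a b ↦ by
    obtain ⟨M, hM⟩ := hw.bounded a b
    refine Measure.integrableOn_of_bounded (M := M) (by simp)
      hw.measurable.aestronglyMeasurable ?_
    filter_upwards [ae_restrict_mem measurableSet_Ioc] with s hs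
    exact hM s ⟨hs.1.le, hs.2⟩
  exact ⟨key a b, key b a⟩

variable [NormedSpace ℝ E]

lemma IsRegularPath.continuous_primitive {w : ℝ → E} (hw : IsRegularPath w) (a : ℝ) :
    Continuous fun t ↦ ∫ s in a..t, w s :=
  intervalIntegral.continuous_primitive (fun _ _ ↦ hw.intervalIntegrable _ _) a

/-- At a jump of `w` the primitive has only a right derivative; this is enough for the comparison
`eq_of_has_deriv_right_eq`. -/
lemma IsRegularPath.hasDerivWithinAt_primitive [CompleteSpace E] {w : ℝ → E} (hw : IsRegularPath w) (a t : ℝ) :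
    HasDerivWithinAt (fun u ↦ ∫ s in a..u, w s) (w t) (Set.Ici t) t :=
  intervalIntegral.integral_hasDerivWithinAt_right (hw.intervalIntegrable a t)
    (t := Set.Ioi t) ⟨Set.univ, univ_mem, hw.measurable.aestronglyMeasurable⟩
    ((hw.rightCts t).mono Set.Ioi_subset_Ici_self)

end Paths

/-! ### Sampling a path along partitions -/

section Partitions

/-- The half-open cells are disjoint, so at most one summand is nonzero; `0 ≤ c` covers the case of
no cell. -/
lemma sum_indicator_Ioc_le {τ : ℕ → ℝ} (hτ : Monotone τ) (N : ℕ) {f : ℕ → ℝ → ℝ} {s c : ℝ}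
    (hc : 0 ≤ c) (h : ∀ i < N, s ∈ Set.Ioc (τ i) (τ (i + 1)) → f i s ≤ c) :
    ∑ i ∈ Finset.range N, (Set.Ioc (τ i) (τ (i + 1))).indicator (f i) s ≤ c := by
  by_cases hi : ∃ i ∈ Finset.range N, s ∈ Set.Ioc (τ i) (τ (i + 1))
  · obtain ⟨i, hiN, hi⟩ := hi
    rw [Finset.sum_eq_single_of_mem i hiN, Set.indicator_of_mem hi]
    · exact h i (Finset.mem_range.1 hiN) hi
    · intro j _ hji
      refine Set.indicator_of_notMem (fun hj ↦ ?_) _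
      exact Set.disjoint_left.1 (hτ.pairwise_disjoint_on_Ioc_succ hji) hj hi
  · push Not at hi
    rw [Finset.sum_eq_zero fun i hiN ↦ Set.indicator_of_notMem (hi i hiN) _]
    exact hc

variable {E : Type*} [NormedAddCommGroup E] [MeasurableSpace E] [BorelSpace E]

/-- Right-endpoint sampling of a regular path is `L¹`-consistent as the mesh tends to zero. -/
lemma tendsto_sum_integral_norm_sub {w : ℝ → E} (hw : IsRegularPath w) {t : ℝ} {N : ℕ → ℕ}
    {τ : ℕ → ℕ → ℝ} (hmono : ∀ k, Monotone (τ k)) (h0 : ∀ k, τ k 0 = 0) (ht : ∀ k, τ k (N k) = t)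
    (hmesh : ∀ δ : ℝ, 0 < δ → ∀ᶠ k in atTop, ∀ i < N k, τ k (i + 1) < τ k i + δ) :
    Tendsto (fun k ↦ ∑ i ∈ Finset.range (N k),
      ∫ s in τ k i..τ k (i + 1), ‖w s - w (τ k (i + 1))‖) atTop (𝓝 0) := by
  obtain ⟨M, hM⟩ := hw.bounded 0 t
  have ht0 : 0 ≤ t := by rw [← ht 0, ← h0 0]; exact hmono 0 (Nat.zero_le _)
  have hM0 : 0 ≤ M := (norm_nonneg _).trans (hM 0 ⟨le_rfl, ht0⟩)
  have hmem : ∀ k i, i < N k → Set.Ioc (τ k i) (τ k (i + 1)) ⊆ Set.Ioc 0 t := fun k i hi ↦ by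
    refine Set.Ioc_subset_Ioc ?_ ?_
    · rw [← h0 k]; exact hmono k (Nat.zero_le _)
    · rw [← ht k]; exact hmono k hi
  set g : ℕ → ℕ → ℝ → ℝ := fun k i s ↦ ‖w s - w (τ k (i + 1))‖ with hg
  have hgm : ∀ k i, Measurable (g k i) := fun k i ↦ (hw.measurable.sub_const _).norm
  have hreg : ∀ k i, IsRegularPath (g k i) := fun k i ↦
    (hw.sub (IsRegularPath.of_continuous continuous_const)).norm
  have heq : ∀ k, ∑ i ∈ Finset.range (N k), ∫ s in τ k i..τ k (i + 1), g k i s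
      = ∫ s in Set.Ioc 0 t, ∑ i ∈ Finset.range (N k),
        (Set.Ioc (τ k i) (τ k (i + 1))).indicator (g k i) s := fun k ↦ by
    rw [integral_finsetSum]
    · refine Finset.sum_congr rfl fun i hi ↦ ?_
      rw [intervalIntegral.integral_of_le (hmono k (Nat.le_succ i)),
        integral_indicator measurableSet_Ioc, Measure.restrict_restrict measurableSet_Ioc,
        Set.inter_eq_left.2 (hmem k i (Finset.mem_range.1 hi))]
    · intro i _
      exact (((hreg k i).intervalIntegrable 0 t).1).indicator measurableSet_Ioc
  change Tendsto (fun k ↦ ∑ i ∈ Finset.range (N k), ∫ s in τ k i..τ k (i + 1), g k i s) _ _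
  simp_rw [heq]
  rw [show 𝓝 (0 : ℝ) = 𝓝 (∫ _ in Set.Ioc 0 t, (0 : ℝ)) by simp]
  refine tendsto_integral_of_dominated_convergence (fun _ ↦ 2 * M) (fun k ↦ ?_) ?_ ?_ ?_
  · exact (Finset.measurable_sum _ fun i _ ↦
      (hgm k i).indicator measurableSet_Ioc).aestronglyMeasurable
  · exact integrable_const _
  · intro k
    refine Eventually.of_forall fun s ↦ ?_
    rw [Real.norm_of_nonneg (Finset.sum_nonneg fun i _ ↦
      Set.indicator_nonneg (fun _ _ ↦ norm_nonneg _) _)]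
    refine sum_indicator_Ioc_le (hmono k) _ (by positivity) fun i hi hs ↦ ?_
    have h1 := hmem k i hi hs
    have h2 := hmem k i hi ⟨hs.1.trans_le hs.2, le_rfl⟩
    refine (norm_sub_le _ _).trans ?_
    have := hM s ⟨h1.1.le, h1.2⟩
    have := hM (τ k (i + 1)) ⟨h2.1.le, h2.2⟩
    linarith
  · refine Eventually.of_forall fun s ↦ ?_
    rw [Metric.tendsto_nhds]
    intro ε hε
    -- The right endpoint of the cell containing `s` lies in `[s, s + δ)` once the mesh is below
    -- `δ`, so right continuity at `s` suffices.
    obtain ⟨δ, hδ, hδw⟩ := Metric.continuousWithinAt_iff.1 (hw.rightCts s) (ε / 2) (half_pos hε)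
    filter_upwards [hmesh δ hδ] with k hk
    rw [Real.dist_eq, sub_zero, abs_of_nonneg (Finset.sum_nonneg fun i _ ↦
      Set.indicator_nonneg (fun _ _ ↦ norm_nonneg _) _)]
    refine lt_of_le_of_lt (sum_indicator_Ioc_le (hmono k) _ (half_pos hε).le fun i hi hs ↦ ?_)
      (half_lt_self hε)
    have := hδw (x := τ k (i + 1)) hs.2 (by
      rw [Real.dist_eq, abs_of_nonneg (by linarith [hs.2])]
      linarith [hs.1, hk i hi])
    rw [dist_comm, dist_eq_norm] at this
    exact this.le

end Partitions

/-! ### The pathwise integral equation: Picard iteration and Euler scheme -/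

section PathwiseEquation

variable {E : Type*} [NormedAddCommGroup E] [NormedSpace ℝ E]

/-- The Euler scheme with step `h` for `V' = b(V + w)`, `V 0 = y`, the path `w` being sampled at
the right endpoints. -/
def eulerScheme (b : E → E) (h : ℝ) (y : E) (w : ℕ → E) : ℕ → E
  | 0 => y
  | k + 1 => eulerScheme b h y w k + h • b (eulerScheme b h y w k + w (k + 1))

/-- `V` is continuous and solves `V(t) = y + ∫_0^t b(V(s) + w(s)) ds` for all `t ≥ 0`. -/
structure IsIntegralSol (b : E → E) (y : E) (w V : ℝ → E) : Prop where
  cont : Continuous V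
  eq : ∀ t, 0 ≤ t → V t = y + ∫ s in (0 : ℝ)..t, b (V s + w s)

/-- Since `1 + a ≤ exp a`, each error `c k` is amplified by at most `exp (a n)`. The recursion is
required only below `n` because the one-step estimates are available only inside `[0, t]`. -/
lemma discrete_gronwall {e c : ℕ → ℝ} {a : ℝ} (ha : 0 ≤ a) (hc : ∀ k, 0 ≤ c k)
    (h0 : e 0 ≤ 0) (n : ℕ) (h : ∀ k < n, e (k + 1) ≤ (1 + a) * e k + c k) :
    e n ≤ Real.exp (a * n) * ∑ k ∈ Finset.range n, c k := by
  induction n with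
  | zero => simpa using h0
  | succ n ih =>
    have h1 := ih fun k hk ↦ h k (hk.trans n.lt_succ_self)
    have h2 := h n n.lt_succ_self
    have hS : 0 ≤ ∑ k ∈ Finset.range n, c k := Finset.sum_nonneg fun k _ ↦ hc k
    have h3 : (1 + a) ≤ Real.exp a := by linarith [Real.add_one_le_exp a]
    have h4 : Real.exp (a * (n + 1 : ℕ)) = Real.exp a * Real.exp (a * n) := by
      rw [← Real.exp_add]; congr 1; push_cast; ring
    have h5 : 1 ≤ Real.exp (a * (n + 1 : ℕ)) := Real.one_le_exp (by positivity)
    rw [Finset.sum_range_succ, mul_add]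
    have h6 : (1 + a) * e n ≤ Real.exp (a * (n + 1 : ℕ)) * ∑ k ∈ Finset.range n, c k := by
      rw [h4, mul_assoc]
      calc (1 + a) * e n ≤ (1 + a) * (Real.exp (a * n) * ∑ k ∈ Finset.range n, c k) :=
            mul_le_mul_of_nonneg_left h1 (by linarith)
        _ ≤ _ := mul_le_mul_of_nonneg_right h3 (by positivity)
    have h7 : c n ≤ Real.exp (a * (n + 1 : ℕ)) * c n := le_mul_of_one_le_left (hc n) h5
    linarith

lemma IsIntegralSol.isRegularPath {b : E → E} {K : ℝ≥0} (hb : LipschitzWith K b) {y : E}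
    {w V : ℝ → E} (hw : IsRegularPath w) (hV : IsIntegralSol b y w V) :
    IsRegularPath fun s ↦ b (V s + w s) :=
  ((IsRegularPath.of_continuous hV.cont).add hw).lipschitz_comp hb

variable [MeasurableSpace E] [BorelSpace E] [SecondCountableTopology E]

/-- Picard iterates for `V' = b(V + w)`, `V 0 = y`. -/
def picardIterate (b : E → E) (y : E) (w : ℝ → E) : ℕ → ℝ → E
  | 0, _ => y
  | n + 1, t => y + ∫ s in (0 : ℝ)..t, b (picardIterate b y w n s + w s)

lemma continuous_picardIterate {b : E → E} {K : ℝ≥0} (hb : LipschitzWith K b) (y : E)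
    {w : ℝ → E} (hw : IsRegularPath w) (n : ℕ) : Continuous (picardIterate b y w n) := by
  induction n with
  | zero => exact continuous_const
  | succ n ih =>
    exact continuous_const.add
      (((IsRegularPath.of_continuous ih).add hw).lipschitz_comp hb |>.continuous_primitive 0)

/-- Restarting a solution at time `s`. -/
lemma IsIntegralSol.shift {b : E → E} {K : ℝ≥0} (hb : LipschitzWith K b) {y : E}
    {w V : ℝ → E} (hw : IsRegularPath w) (hV : IsIntegralSol b y w V) {s : ℝ} (hs : 0 ≤ s) :
    IsIntegralSol b (V s + w s) (fun u ↦ w (s + u) - w s) (fun u ↦ V (s + u) + w s) := by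
  have hr := hV.isRegularPath hb hw
  refine ⟨(hV.cont.comp (by fun_prop)).add continuous_const, fun t ht ↦ ?_⟩
  have h1 : ∀ u, V (s + u) + w s + (w (s + u) - w s) = V (s + u) + w (s + u) := fun u ↦ by abel
  simp only [h1]
  rw [intervalIntegral.integral_comp_add_left (fun u ↦ b (V u + w u)), add_zero,
    hV.eq (s + t) (by positivity), hV.eq s hs,
    ← intervalIntegral.integral_add_adjacent_intervals (hr.intervalIntegrable 0 s)
      (hr.intervalIntegrable s (s + t))]
  abel

/-- With the exponential weight of rate `2(K+1)`, each Picard step halves the distance. Hence no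
smallness of `T` is needed, and `K + 1` in place of `K` keeps the rate positive. -/
lemma exists_dist_picardIterate_le {b : E → E} {K : ℝ≥0} (hb : LipschitzWith K b) (y : E)
    {w : ℝ → E} (hw : IsRegularPath w) (T : ℝ) :
    ∃ D : ℝ, 0 ≤ D ∧ ∀ n, ∀ t ∈ Set.Icc 0 T,
      ‖picardIterate b y w (n + 1) t - picardIterate b y w n t‖
        ≤ D / 2 / 2 ^ n * Real.exp (2 * (K + 1) * t) := by
  have hreg : ∀ n, IsRegularPath fun s ↦ b (picardIterate b y w n s + w s) := fun n ↦
    ((IsRegularPath.of_continuous (continuous_picardIterate hb y hw n)).add hw).lipschitz_comp hb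
  obtain ⟨D, hD⟩ := bounded_of_continuous ((continuous_picardIterate hb y hw 1).sub
    (continuous_picardIterate hb y hw 0)) 0 T
  -- The `max` keeps the constant nonnegative even when `T < 0` and the bound `D` carries no
  -- information.
  refine ⟨2 * max D 0, by positivity, fun n ↦ ?_⟩
  induction n with
  | zero =>
    intro t ht
    have h1 : 1 ≤ Real.exp (2 * (K + 1) * t) := Real.one_le_exp (by have := ht.1; positivity)
    have h2 := (hD t ht).trans (le_max_left D 0)
    have h3 := le_mul_of_one_le_right (le_max_right D 0) h1
    simp only [pow_zero, div_one]
    rw [mul_div_cancel_left₀ _ (two_ne_zero)]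
    exact h2.trans h3
  | succ n ih =>
    intro t ht
    set C := 2 * max D 0 / 2 / 2 ^ n with hC
    have hC0 : 0 ≤ C := by positivity
    have h1 : picardIterate b y w (n + 1 + 1) t - picardIterate b y w (n + 1) t
        = ∫ s in (0 : ℝ)..t, (b (picardIterate b y w (n + 1) s + w s)
          - b (picardIterate b y w n s + w s)) := by
      rw [intervalIntegral.integral_sub ((hreg _).intervalIntegrable _ _)
        ((hreg _).intervalIntegrable _ _)]
      change y + _ - (y + _) = _
      abel
    have hexp : Continuous fun s : ℝ ↦ C * (K + 1) * Real.exp (2 * (K + 1) * s) := by fun_prop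
    have h2 : ‖picardIterate b y w (n + 1 + 1) t - picardIterate b y w (n + 1) t‖
        ≤ ∫ s in (0 : ℝ)..t, C * (K + 1) * Real.exp (2 * (K + 1) * s) := by
      rw [h1]
      refine intervalIntegral.norm_integral_le_of_norm_le ht.1
        (Eventually.of_forall fun s hs ↦ ?_) (hexp.intervalIntegrable _ _)
      refine (hb.norm_sub_le _ _).trans ?_
      rw [add_sub_add_right_eq_sub]
      have h3 := ih s ⟨hs.1.le, hs.2.trans ht.2⟩
      have hK : (0 : ℝ) ≤ K := K.2
      calc (K : ℝ) * ‖picardIterate b y w (n + 1) s - picardIterate b y w n s‖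
          ≤ (K + 1) * (C * Real.exp (2 * (K + 1) * s)) :=
            mul_le_mul (by linarith) h3 (norm_nonneg _) (by positivity)
        _ = _ := by ring
    refine h2.trans ?_
    have hK : (0 : ℝ) < 2 * (K + 1) := by have : (0 : ℝ) ≤ K := K.2; positivity
    have h4 : ∫ s in (0 : ℝ)..t, C * (K + 1) * Real.exp (2 * (K + 1) * s)
        = C / 2 * (Real.exp (2 * (K + 1) * t) - 1) := by
      rw [intervalIntegral.integral_const_mul,
        intervalIntegral.integral_comp_mul_left _ hK.ne', integral_exp, mul_zero, Real.exp_zero,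
        smul_eq_mul]
      field_simp
    rw [h4]
    have h5 : 2 * max D 0 / 2 / 2 ^ (n + 1) = C / 2 := by rw [hC, pow_succ]; field_simp
    rw [h5]
    exact mul_le_mul_of_nonneg_left (by linarith) (by positivity)

variable [CompleteSpace E]

/-- The Euler scheme converges to any solution of the integral equation. -/
theorem IsIntegralSol.tendsto_eulerScheme {b : E → E} {K : ℝ≥0} (hb : LipschitzWith K b) {y : E}
    {w V : ℝ → E} (hw : IsRegularPath w) (hV : IsIntegralSol b y w V) {t : ℝ} (ht : 0 ≤ t) :
    Tendsto (fun n : ℕ ↦ eulerScheme b (t / (n + 1)) y (fun k ↦ w (k * (t / (n + 1)))) (n + 1))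
      atTop (𝓝 (V t)) := by
  have hr := hV.isRegularPath hb hw
  obtain ⟨M, hM⟩ := hr.bounded 0 t
  have hM0 : 0 ≤ M := (norm_nonneg _).trans (hM 0 ⟨le_rfl, ht⟩)
  set τ : ℕ → ℕ → ℝ := fun n k ↦ k * (t / (n + 1)) with hτ
  have hh : ∀ n : ℕ, 0 ≤ t / ((n : ℝ) + 1) := fun n ↦ by positivity
  have hstep : ∀ n k, τ n (k + 1) = τ n k + t / (n + 1) := fun n k ↦ by
    simp only [hτ]; push_cast; ring
  have hmono : ∀ n, Monotone (τ n) := fun n ↦ monotone_nat_of_le_succ fun k ↦ by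
    rw [hstep]; linarith [hh n]
  have h0 : ∀ n, τ n 0 = 0 := fun n ↦ by simp [hτ]
  have hend : ∀ n, τ n (n + 1) = t := fun n ↦ by
    simp only [hτ]; push_cast; field_simp
  have hdiv : Tendsto (fun n : ℕ ↦ t / ((n : ℝ) + 1)) atTop (𝓝 0) := by
    simpa [div_eq_mul_inv] using
      (tendsto_one_div_add_atTop_nhds_zero_nat (𝕜 := ℝ)).const_mul t
  have hR := tendsto_sum_integral_norm_sub hw (N := fun n ↦ n + 1) hmono h0 hend fun δ hδ ↦ by
    filter_upwards [hdiv.eventually_lt_const hδ] with n hn i _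
    rw [hstep]; linarith
  set R : ℕ → ℝ := fun n ↦ ∑ i ∈ Finset.range (n + 1),
      ∫ s in τ n i..τ n (i + 1), ‖w s - w (τ n (i + 1))‖ with hRdef
  -- One Euler step has two sources of error: the motion of `V` within the step, at most `M h`
  -- because `b(V + w)` is bounded by `M` on `[0, t]`, and the sampling of `w` at the right
  -- endpoint, which sums to `R n`.
  have hbound : ∀ n : ℕ, ‖eulerScheme b (t / (n + 1)) y (fun k ↦ w (k * (t / (n + 1)))) (n + 1)
      - V t‖ ≤ Real.exp (K * t) * (K * (M * (t / (n + 1)) * t + R n)) := by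
    intro n
    set h := t / ((n : ℝ) + 1) with hhdef
    set e := eulerScheme b h y (fun k ↦ w (k * h)) with he
    have hincr : ∀ u v, 0 ≤ u → u ≤ v → V v - V u = ∫ s in u..v, b (V s + w s) := by
      intro u v hu huv
      rw [hV.eq v (hu.trans huv), hV.eq u hu, add_sub_add_left_eq_sub,
        intervalIntegral.integral_interval_sub_left (hr.intervalIntegrable _ _)
          (hr.intervalIntegrable _ _)]
    have key := discrete_gronwall (e := fun k ↦ ‖e k - V (τ n k)‖)
      (c := fun k ↦ K * (M * h * h + ∫ s in τ n k..τ n (k + 1), ‖w s - w (τ n (k + 1))‖))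
      (a := K * h) (mul_nonneg K.2 (hh n)) (fun k ↦ by
        refine mul_nonneg K.2 (add_nonneg (mul_nonneg (mul_nonneg hM0 (hh n)) (hh n)) ?_)
        exact intervalIntegral.integral_nonneg (hmono n (Nat.le_succ k)) fun _ _ ↦ norm_nonneg _)
      (by simp [he, eulerScheme, h0, hV.eq 0 le_rfl]) (n + 1) (by
        intro k hk
        have hle : τ n k ≤ τ n (k + 1) := hmono n (Nat.le_succ k)
        have hk0 : 0 ≤ τ n k := by rw [← h0 n]; exact hmono n (Nat.zero_le _)
        have hkt : τ n (k + 1) ≤ t := (hmono n (show k + 1 ≤ n + 1 by omega)).trans_eq (hend n)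
        have hlen : τ n (k + 1) - τ n k = h := by rw [hstep]; ring
        have h1 : e (k + 1) - V (τ n (k + 1)) = (e k - V (τ n k))
            + ∫ s in τ n k..τ n (k + 1), (b (e k + w (τ n (k + 1))) - b (V s + w s)) := by
          rw [intervalIntegral.integral_sub (by simp) (hr.intervalIntegrable _ _),
            intervalIntegral.integral_const, hlen, ← hincr _ _ hk0 hle]
          have : e (k + 1) = e k + h • b (e k + w (τ n (k + 1))) := rfl
          rw [this]
          abel
        have h2 : ‖∫ s in τ n k..τ n (k + 1), (b (e k + w (τ n (k + 1))) - b (V s + w s))‖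
            ≤ ∫ s in τ n k..τ n (k + 1), (K * (‖e k - V (τ n k)‖ + M * h)
              + K * ‖w s - w (τ n (k + 1))‖) := by
          refine intervalIntegral.norm_integral_le_of_norm_le hle ?_ ?_
          · refine Eventually.of_forall fun s hs ↦ ?_
            have h3 : ‖V s - V (τ n k)‖ ≤ M * h := by
              rw [hincr _ _ hk0 hs.1.le]
              refine (intervalIntegral.norm_integral_le_of_norm_le_const (C := M) ?_).trans ?_
              · intro u hu
                rw [Set.uIoc_of_le hs.1.le] at hu
                exact hM u ⟨hk0.trans hu.1.le, hu.2.trans (hs.2.trans hkt)⟩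
              · rw [abs_of_nonneg (by linarith [hs.1])]
                exact mul_le_mul_of_nonneg_left (by linarith [hs.2]) hM0
            have h4 := hb.norm_sub_le (e k + w (τ n (k + 1))) (V s + w s)
            have h5 : e k + w (τ n (k + 1)) - (V s + w s)
                = (e k - V (τ n k)) - (V s - V (τ n k)) - (w s - w (τ n (k + 1))) := by abel
            rw [h5] at h4
            refine h4.trans ?_
            rw [← mul_add]
            refine mul_le_mul_of_nonneg_left ?_ K.2
            refine (norm_sub_le _ _).trans (add_le_add_left ?_ _)
            exact (norm_sub_le _ _).trans (add_le_add_right h3 _)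
          · refine IntervalIntegrable.add (by simp) ?_
            exact ((hw.sub (IsRegularPath.of_continuous continuous_const)).norm.intervalIntegrable
              _ _).const_mul _
        rw [intervalIntegral.integral_add (by simp)
          (((hw.sub (IsRegularPath.of_continuous continuous_const)).norm.intervalIntegrable
              _ _).const_mul _), intervalIntegral.integral_const,
          intervalIntegral.integral_const_mul, hlen, smul_eq_mul] at h2
        simp only [h1]
        refine (norm_add_le _ _).trans ((add_le_add_right h2 _).trans_eq ?_)
        ring)
    rw [hend] at key
    refine key.trans_eq ?_
    rw [← Finset.mul_sum, Finset.sum_add_distrib, Finset.sum_const, Finset.card_range,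
      nsmul_eq_mul]
    have h6 : K * h * ((n + 1 : ℕ) : ℝ) = K * t := by
      rw [hhdef]; push_cast; field_simp
    have h7 : ((n + 1 : ℕ) : ℝ) * (M * h * h) = M * h * t := by
      rw [hhdef]; push_cast; field_simp
    rw [h6, h7]
  rw [tendsto_iff_norm_sub_tendsto_zero]
  refine squeeze_zero (fun _ ↦ norm_nonneg _) hbound ?_
  have := (((hdiv.const_mul M).mul_const t).add hR).const_mul (K : ℝ) |>.const_mul
    (Real.exp (K * t))
  simpa using this

/-- The geometric bound makes the iterates converge uniformly on each `[0, T]`, and the Lipschitz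
property of `b` carries the limit through the integral. -/
theorem exists_isIntegralSol {b : E → E} {K : ℝ≥0} (hb : LipschitzWith K b) (y : E)
    {w : ℝ → E} (hw : IsRegularPath w) : ∃ V, IsIntegralSol b y w V := by
  set p := picardIterate b y w with hp
  have hcont := continuous_picardIterate hb y hw
  have hlim : ∀ t, 0 ≤ t → ∃ v, Tendsto (fun n ↦ p n t) atTop (𝓝 v) := fun t ht ↦ by
    obtain ⟨D, hD0, hD⟩ := exists_dist_picardIterate_le hb y hw t
    refine cauchySeq_tendsto_of_complete
      (cauchySeq_of_le_geometric_two (C := D * Real.exp (2 * (K + 1) * t)) fun n ↦ ?_)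
    rw [dist_comm, dist_eq_norm]
    refine (hD n t ⟨ht, le_rfl⟩).trans_eq ?_
    ring
  choose! v hv using hlim
  have hdist : ∀ T, ∃ C, ∀ n, ∀ t ∈ Set.Icc 0 T, dist (p n t) (v t) ≤ C / 2 ^ n := fun T ↦ by
    obtain ⟨D, hD0, hD⟩ := exists_dist_picardIterate_le hb y hw T
    refine ⟨D * Real.exp (2 * (K + 1) * T), fun n t ht ↦ ?_⟩
    refine dist_le_of_le_geometric_two_of_tendsto (fun m ↦ ?_) (hv t ht.1) n
    rw [dist_comm, dist_eq_norm]
    refine (hD m t ht).trans ?_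
    have h1 : Real.exp (2 * (K + 1) * t) ≤ Real.exp (2 * (K + 1) * T) :=
      Real.exp_le_exp.2 (mul_le_mul_of_nonneg_left ht.2 (by have : (0 : ℝ) ≤ K := K.2; positivity))
    refine (mul_le_mul_of_nonneg_left h1 (by positivity)).trans_eq ?_
    ring
  have hunif : ∀ T, TendstoUniformlyOn p v atTop (Set.Icc 0 T) := fun T ↦ by
    obtain ⟨C, hC⟩ := hdist T
    rw [Metric.tendstoUniformlyOn_iff]
    intro ε hε
    have h1 : Tendsto (fun n : ℕ ↦ C / (2 : ℝ) ^ n) atTop (𝓝 0) := by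
      simpa [div_eq_mul_inv] using
        (tendsto_pow_atTop_nhds_zero_of_lt_one (r := (2 : ℝ)⁻¹) (by norm_num)
          (by norm_num)).const_mul C
    filter_upwards [h1.eventually_lt_const hε] with n hn t ht
    rw [dist_comm]
    exact (hC n t ht).trans_lt hn
  have hvcont : ContinuousOn v (Set.Ici 0) := fun t ht ↦ by
    have h1 : ContinuousOn v (Set.Icc 0 (t + 1)) :=
      (hunif (t + 1)).continuousOn (Eventually.of_forall fun n ↦ (hcont n).continuousOn).frequently
    refine (h1 t ⟨ht, by linarith⟩).mono_of_mem_nhdsWithin ?_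
    rw [← Set.Ici_inter_Iic]
    exact inter_mem_nhdsWithin _ (Iic_mem_nhds (by linarith))
  -- The iterates are controlled only for `t ≥ 0`; freezing the limit at its value at `0` makes it
  -- continuous on the whole line.
  have hVc : Continuous fun t ↦ v (max t 0) :=
    hvcont.comp_continuous (by fun_prop) fun t ↦ Set.mem_Ici.2 (le_max_right t 0)
  refine ⟨fun t ↦ v (max t 0), hVc, fun t ht ↦ ?_⟩
  refine tendsto_nhds_unique ((hv _ (le_max_right t 0)).comp (tendsto_add_atTop_nat 1)) ?_
  rw [max_eq_left ht]
  refine tendsto_const_nhds.add ?_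
  have hreg : ∀ n, IsRegularPath fun s ↦ b (p n s + w s) := fun n ↦
    ((IsRegularPath.of_continuous (hcont n)).add hw).lipschitz_comp hb
  have hregV : IsRegularPath fun s ↦ b (v (max s 0) + w s) :=
    ((IsRegularPath.of_continuous hVc).add hw).lipschitz_comp hb
  obtain ⟨C, hC⟩ := hdist t
  rw [tendsto_iff_norm_sub_tendsto_zero]
  refine squeeze_zero (g := fun n : ℕ ↦ K * (C / 2 ^ n) * |t - 0|) (fun _ ↦ norm_nonneg _)
    (fun n ↦ ?_) ?_
  · rw [← intervalIntegral.integral_sub ((hreg n).intervalIntegrable _ _)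
      (hregV.intervalIntegrable _ _)]
    refine intervalIntegral.norm_integral_le_of_norm_le_const fun s hs ↦ ?_
    rw [Set.uIoc_of_le ht] at hs
    refine (hb.norm_sub_le _ _).trans (mul_le_mul_of_nonneg_left ?_ K.2)
    rw [add_sub_add_right_eq_sub, max_eq_left hs.1.le, ← dist_eq_norm]
    exact hC n s ⟨hs.1.le, hs.2⟩
  · have h1 : Tendsto (fun n : ℕ ↦ C / (2 : ℝ) ^ n) atTop (𝓝 0) := by
      simpa [div_eq_mul_inv] using
        (tendsto_pow_atTop_nhds_zero_of_lt_one (r := (2 : ℝ)⁻¹) (by norm_num)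
          (by norm_num)).const_mul C
    simpa using (h1.const_mul (K : ℝ)).mul_const |t - 0|

end PathwiseEquation

/-! ### Variation of constants and summation by parts -/

section VariationOfConstants

variable {E : Type*} [NormedAddCommGroup E] [NormedSpace ℝ E]

lemma exp_zero_smul (A : E →L[ℝ] E) : NormedSpace.exp ((0 : ℝ) • A) = 1 := by
  rw [zero_smul, NormedSpace.exp_zero]

variable [CompleteSpace E]

lemma exp_sub_smul (A : E →L[ℝ] E) (t s : ℝ) :
    NormedSpace.exp ((t - s) • A)
      = NormedSpace.exp (t • A) * NormedSpace.exp ((-s) • A) := by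
  let _ : NormedAlgebra ℚ (E →L[ℝ] E) := NormedAlgebra.restrictScalars ℚ ℝ _
  rw [← NormedSpace.exp_add_of_commute (((Commute.refl A).smul_left t).smul_right (-s)),
    ← add_smul, sub_eq_add_neg]


lemma exp_smul_mul_exp_neg_smul (A : E →L[ℝ] E) (t : ℝ) :
    NormedSpace.exp (t • A) * NormedSpace.exp ((-t) • A) = 1 := by
  rw [← exp_sub_smul, sub_self, zero_smul, NormedSpace.exp_zero]

lemma continuous_exp_smul (A : E →L[ℝ] E) :
    Continuous fun t : ℝ ↦ NormedSpace.exp (t • A) :=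
  continuous_iff_continuousAt.2 fun t ↦ (hasDerivAt_exp_smul_const A t).continuousAt

variable [MeasurableSpace E] [BorelSpace E] [SecondCountableTopology E]

/-- Pulling `e^{tA}` out leaves a primitive whose integrand no longer depends on `t`, so the
convolution can be differentiated by the product rule. -/
lemma integral_exp_sub_smul (A : E →L[ℝ] E) {g : ℝ → E} (hg : IsRegularPath g) (t : ℝ) :
    ∫ s in (0 : ℝ)..t, NormedSpace.exp ((t - s) • A) (g s)
      = NormedSpace.exp (t • A) (∫ s in (0 : ℝ)..t, NormedSpace.exp ((-s) • A) (g s)) := by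
  rw [← ContinuousLinearMap.intervalIntegral_comp_comm]
  · simp_rw [exp_sub_smul]
    rfl
  · exact (hg.clm_apply ((continuous_exp_smul A).comp continuous_neg)).intervalIntegrable _ _

/-- Variation of constants for `V' = A V + g` with a regular forcing `g`. -/
theorem integral_eq_iff_mild (A : E →L[ℝ] E) (x : E) {g V : ℝ → E} (hg : IsRegularPath g)
    (hV : Continuous V) :
    (∀ t, 0 ≤ t → V t = x + ∫ s in (0 : ℝ)..t, (A (V s) + g s)) ↔
      ∀ t, 0 ≤ t → V t = NormedSpace.exp (t • A) x
        + ∫ s in (0 : ℝ)..t, NormedSpace.exp ((t - s) • A) (g s) := by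
  have hAg : IsRegularPath fun s ↦ A (V s) + g s :=
    (IsRegularPath.of_continuous (A.continuous.comp hV)).add hg
  have hSg : IsRegularPath fun s ↦ NormedSpace.exp ((-s) • A) (g s) :=
    hg.clm_apply ((continuous_exp_smul A).comp continuous_neg)
  have hU : ∀ t, NormedSpace.exp (t • A) x
      + ∫ s in (0 : ℝ)..t, NormedSpace.exp ((t - s) • A) (g s)
      = NormedSpace.exp (t • A) (x + ∫ s in (0 : ℝ)..t, NormedSpace.exp ((-s) • A) (g s)) :=
    fun t ↦ by rw [integral_exp_sub_smul A hg, map_add]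
  have hint : ∀ t, HasDerivWithinAt (fun t ↦ x + ∫ s in (0 : ℝ)..t, (A (V s) + g s))
      (A (V t) + g t) (Set.Ici t) t := fun t ↦ (hAg.hasDerivWithinAt_primitive 0 t).const_add x
  have hmild : ∀ t, HasDerivWithinAt
      (fun t ↦ x + ∫ s in (0 : ℝ)..t, NormedSpace.exp ((-s) • A) (g s))
      (NormedSpace.exp ((-t) • A) (g t)) (Set.Ici t) t :=
    fun t ↦ (hSg.hasDerivWithinAt_primitive 0 t).const_add x
  have hcint : Continuous fun t ↦ x + ∫ s in (0 : ℝ)..t, (A (V s) + g s) :=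
    continuous_const.add (hAg.continuous_primitive 0)
  have hcmild : Continuous fun t ↦ x + ∫ s in (0 : ℝ)..t, NormedSpace.exp ((-s) • A) (g s) :=
    continuous_const.add (hSg.continuous_primitive 0)
  simp_rw [hU]
  constructor
  · intro h t ht
    -- Multiply by the integrating factor `e^{-sA}`: the terms with `A` cancel, and both sides have
    -- right derivative `e^{-sA} g(s)`.
    have hW : ∀ s ∈ Set.Icc 0 t, NormedSpace.exp ((-s) • A)
        (x + ∫ r in (0 : ℝ)..s, (A (V r) + g r))
        = x + ∫ r in (0 : ℝ)..s, NormedSpace.exp ((-r) • A) (g r) := by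
      refine eq_of_has_deriv_right_eq (f' := fun s ↦ NormedSpace.exp ((-s) • A) (g s))
        (fun s hs ↦ ?_) (fun s _ ↦ hmild s)
        ((((continuous_exp_smul A).comp continuous_neg).clm_apply hcint).continuousOn)
        hcmild.continuousOn (by simp)
      have h1 : HasDerivAt (fun s : ℝ ↦ NormedSpace.exp ((-s) • A))
          (-(NormedSpace.exp ((-s) • A) * A)) s := by
        simpa [Function.comp_def] using
          (hasDerivAt_exp_smul_const A (-s)).scomp s (hasDerivAt_neg s)
      have h2 := (h1.hasDerivWithinAt (s := Set.Ici s)).clm_apply (hint s)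
      refine h2.congr_deriv ?_
      rw [← h s hs.1, map_add]
      simp
    rw [← hW t ⟨ht, le_rfl⟩, ← h t ht, ← mul_apply_eq_comp,
      exp_smul_mul_exp_neg_smul, one_apply_eq_self]
  · intro h t ht
    -- Conversely, the product rule gives the mild expression the right derivative `A V + g`, and
    -- both sides equal `x` at time `0`.
    rw [h t ht]
    refine eq_of_has_deriv_right_eq (f' := fun s ↦ A (V s) + g s) (a := 0) (b := t)
      (fun s hs ↦ ?_) (fun s _ ↦ hint s)
      (((continuous_exp_smul A).clm_apply hcmild).continuousOn)
      hcint.continuousOn (by simp) t ⟨ht, le_rfl⟩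
    have h2 := ((hasDerivAt_exp_smul_const' A s).hasDerivWithinAt (s := Set.Ici s)).clm_apply
      (hmild s)
    refine h2.congr_deriv ?_
    rw [mul_apply_eq_comp, ← h s hs.1, ← mul_apply_eq_comp,
      exp_smul_mul_exp_neg_smul, one_apply_eq_self]

/-- Left-point Riemann sums of a smooth operator-valued function against a regular path converge,
by summation by parts. -/
theorem tendsto_sum_clm_apply_sub {w : ℝ → E} (hw : IsRegularPath w)
    {Φ Φ' : ℝ → E →L[ℝ] E} (hΦ : ∀ s, HasDerivAt Φ (Φ' s) s) (hΦ' : Continuous Φ')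
    {t : ℝ} {N : ℕ → ℕ}
    {τ : ℕ → ℕ → ℝ} (hmono : ∀ k, Monotone (τ k)) (h0 : ∀ k, τ k 0 = 0) (ht : ∀ k, τ k (N k) = t)
    (hmesh : ∀ δ : ℝ, 0 < δ → ∀ᶠ k in atTop, ∀ i < N k, τ k (i + 1) < τ k i + δ) :
    Tendsto (fun k ↦ ∑ i ∈ Finset.range (N k), Φ (τ k i) (w (τ k (i + 1)) - w (τ k i))) atTop
      (𝓝 (Φ t (w t) - Φ 0 (w 0) - ∫ s in (0 : ℝ)..t, Φ' s (w s))) := by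
  obtain ⟨C, hC⟩ := bounded_of_continuous hΦ' 0 t
  have ht0 : 0 ≤ t := by rw [← ht 0, ← h0 0]; exact hmono 0 (Nat.zero_le _)
  have hreg : IsRegularPath fun s ↦ Φ' s (w s) := hw.clm_apply hΦ'
  rw [tendsto_iff_norm_sub_tendsto_zero]
  refine squeeze_zero (fun _ ↦ norm_nonneg _) (fun k ↦ ?_)
    (by simpa using (tendsto_sum_integral_norm_sub hw hmono h0 ht hmesh).const_mul C)
  have h1 : Φ t (w t) - Φ 0 (w 0)
      = ∑ i ∈ Finset.range (N k), (Φ (τ k (i + 1)) (w (τ k (i + 1))) - Φ (τ k i) (w (τ k i))) := by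
    rw [Finset.sum_range_sub (fun i ↦ Φ (τ k i) (w (τ k i))), ht, h0]
  have h2 : ∫ s in (0 : ℝ)..t, Φ' s (w s)
      = ∑ i ∈ Finset.range (N k), ∫ s in τ k i..τ k (i + 1), Φ' s (w s) := by
    rw [intervalIntegral.sum_integral_adjacent_intervals
      (fun i _ ↦ hreg.intervalIntegrable _ _), ht, h0]
  rw [h1, h2, ← Finset.sum_sub_distrib, ← Finset.sum_sub_distrib, Finset.mul_sum]
  refine norm_sum_le_of_le _ fun i hi ↦ ?_
  have hle : τ k i ≤ τ k (i + 1) := hmono k (Nat.le_succ i)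
  have hi0 : 0 ≤ τ k i := by rw [← h0 k]; exact hmono k (Nat.zero_le _)
  have hit : τ k (i + 1) ≤ t := (hmono k (Finset.mem_range.1 hi)).trans_eq (ht k)
  have h3 : (Φ (τ k (i + 1)) - Φ (τ k i)) (w (τ k (i + 1)))
      = ∫ s in τ k i..τ k (i + 1), Φ' s (w (τ k (i + 1))) := by
    rw [← intervalIntegral.integral_eq_sub_of_hasDerivAt (fun s _ ↦ hΦ s)
      (hΦ'.intervalIntegrable _ _),
      ContinuousLinearMap.intervalIntegral_apply (hΦ'.intervalIntegrable _ _)]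
  -- On one cell the left-point term differs from the integration-by-parts expression exactly by
  -- `Φ'` integrated against the right-endpoint sampling error of `w`.
  have h4 : Φ (τ k i) (w (τ k (i + 1)) - w (τ k i))
      - (Φ (τ k (i + 1)) (w (τ k (i + 1))) - Φ (τ k i) (w (τ k i))
        - ∫ s in τ k i..τ k (i + 1), Φ' s (w s))
      = ∫ s in τ k i..τ k (i + 1), Φ' s (w s - w (τ k (i + 1))) := by
    simp_rw [map_sub]
    rw [intervalIntegral.integral_sub (hreg.intervalIntegrable _ _)
      ((hΦ'.clm_apply continuous_const).intervalIntegrable _ _), ← h3,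
      sub_apply]
    abel
  rw [h4, ← intervalIntegral.integral_const_mul]
  refine intervalIntegral.norm_integral_le_of_norm_le hle (Eventually.of_forall fun s hs ↦ ?_)
    (((hw.sub (IsRegularPath.of_continuous continuous_const)).norm.intervalIntegrable
              _ _).const_mul _)
  refine ((Φ' s).le_opNorm _).trans (mul_le_mul_of_nonneg_right ?_ (norm_nonneg _))
  exact hC s ⟨hi0.trans hs.1.le, hs.2.trans hit⟩

end VariationOfConstants

/-! ### Càdlàg paths are regular -/

section Cadlag

variable {E : Type*} [NormedAddCommGroup E]

/-- Near each time the left limit bounds the path on the left and right continuity bounds it on the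
right; compactness of the interval does the rest. -/
lemma IsCadlag.bounded {f : ℝ≥0 → E} (hf : IsCadlag f) (T : ℝ≥0) :
    ∃ M, ∀ s ∈ Set.Icc 0 T, ‖f s‖ ≤ M := by
  refine isCompact_Icc.induction_on (p := fun S ↦ ∃ M, ∀ s ∈ S, ‖f s‖ ≤ M) ⟨0, by simp⟩
    (fun S S' h ⟨M, hM⟩ ↦ ⟨M, fun s hs ↦ hM s (h hs)⟩)
    (fun S S' ⟨M, hM⟩ ⟨M', hM'⟩ ↦ ⟨max M M', ?_⟩) (fun t _ ↦ ?_)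
  · rintro s (hs | hs)
    · exact (hM s hs).trans (le_max_left _ _)
    · exact (hM' s hs).trans (le_max_right _ _)
  · obtain ⟨hr, l, hl⟩ := hf t
    have h1 : ∀ᶠ s in 𝓝[≥] t, ‖f s‖ ≤ max (‖f t‖ + 1) (‖l‖ + 1) := by
      filter_upwards [hr.norm.eventually_lt_const (lt_add_one ‖f t‖)] with s hs
      exact hs.le.trans (le_max_left _ _)
    have h2 : ∀ᶠ s in 𝓝[<] t, ‖f s‖ ≤ max (‖f t‖ + 1) (‖l‖ + 1) := by
      filter_upwards [hl.norm.eventually_lt_const (lt_add_one ‖l‖)] with s hs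
      exact hs.le.trans (le_max_right _ _)
    have h3 : ∀ᶠ s in 𝓝 t, ‖f s‖ ≤ max (‖f t‖ + 1) (‖l‖ + 1) := by
      rw [← nhdsLT_sup_nhdsGE, eventually_sup]
      exact ⟨h2, h1⟩
    exact ⟨_, nhdsWithin_le_nhds h3, _, fun s hs ↦ hs⟩

/-- `Real.toNNReal` is continuous and monotone, so it preserves approach from the right; at negative
times the path is frozen at its initial value. -/
lemma IsCadlag.isRegularPath {f : ℝ≥0 → E} (hf : IsCadlag f) :
    IsRegularPath fun s : ℝ ↦ f s.toNNReal := by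
  refine ⟨fun s ↦ ?_, fun a b ↦ ?_⟩
  · exact (hf s.toNNReal).1.comp continuous_real_toNNReal.continuousWithinAt
      fun u hu ↦ Real.toNNReal_mono hu
  · obtain ⟨M, hM⟩ := hf.bounded b.toNNReal
    exact ⟨M, fun s hs ↦ hM _ ⟨zero_le, Real.toNNReal_mono hs.2⟩⟩

lemma IsCadlag.add {f g : ℝ≥0 → E} (hf : IsCadlag f) (hg : IsCadlag g) :
    IsCadlag fun t ↦ f t + g t := fun t ↦ by
  obtain ⟨h1, l, hl⟩ := hf t
  obtain ⟨h2, m, hm⟩ := hg t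
  exact ⟨h1.add h2, l + m, hl.add hm⟩

lemma IsCadlag.of_continuous {f : ℝ≥0 → E} (hf : Continuous f) : IsCadlag f := fun t ↦
  ⟨hf.continuousWithinAt, f t, hf.continuousAt.tendsto.mono_left nhdsWithin_le_nhds⟩

lemma IsCadlag.continuous_comp {F : Type*} [NormedAddCommGroup F] {f : ℝ≥0 → E}
    (hf : IsCadlag f) {g : E → F} (hg : Continuous g) : IsCadlag fun t ↦ g (f t) := fun t ↦ by
  obtain ⟨h1, l, hl⟩ := hf t
  exact ⟨hg.continuousAt.comp_continuousWithinAt h1, g l, (hg.tendsto l).comp hl⟩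

end Cadlag

/-! ### Finite time grids -/

section TimeGrids

/-- Puts finitely many times on one increasing grid from `0`, the form in which independence of
increments applies. The enumeration stays at the largest time once the set is exhausted. -/
lemma exists_monotone_enumeration (S : Finset ℝ≥0) :
    ∃ τ : ℕ → ℝ≥0, Monotone τ ∧ τ 0 = 0 ∧ ∀ u ∈ S, ∃ m, τ m = u := by
  classical
  set S' := insert 0 S with hS'
  have hcard : 0 < S'.card := Finset.card_pos.2 ⟨0, Finset.mem_insert_self _ _⟩
  refine ⟨fun k ↦ S'.orderEmbOfFin rfl ⟨min k (S'.card - 1), by omega⟩, fun a b hab ↦ ?_, ?_,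
    fun u hu ↦ ?_⟩
  · refine (S'.orderEmbOfFin rfl).monotone ?_
    simp only [Fin.mk_le_mk]
    omega
  · have h0 : (0 : ℝ≥0) ∈ Set.range (S'.orderEmbOfFin rfl) := by
      rw [Finset.range_orderEmbOfFin]; exact Finset.mem_insert_self _ _
    obtain ⟨i, hi⟩ := h0
    refine le_antisymm ?_ zero_le
    rw [← hi]
    refine (S'.orderEmbOfFin rfl).monotone ?_
    simp [Fin.le_def]
  · have hu' : u ∈ Set.range (S'.orderEmbOfFin rfl) := by
      rw [Finset.range_orderEmbOfFin]; exact Finset.mem_insert_of_mem hu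
    obtain ⟨i, hi⟩ := hu'
    refine ⟨i, ?_⟩
    rw [← hi]
    refine congrArg (S'.orderEmbOfFin rfl) (Fin.ext ?_)
    have := i.2
    change min (i : ℕ) (S'.card - 1) = i
    omega

lemma sum_range_increments {Ω : Type*} {z : ℝ≥0 → Ω → ℝ} (τ : ℕ → ℝ≥0) {m n : ℕ} (hmn : m ≤ n) (ω : Ω) :
    z (τ n) ω - z (τ m) ω = ∑ k ∈ Finset.Ico m n, (z (τ (k + 1)) ω - z (τ k) ω) :=
  (Finset.sum_Ico_sub (fun k ↦ z (τ k) ω) hmn).symm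

end TimeGrids

/-! ### The Lévy noise: càdlàg modification, independence and law of increments -/

section Noise

variable {Ω : Type*} [mΩ : MeasurableSpace Ω] {P : Measure Ω}
  {z : ℝ≥0 → Ω → ℝ}

lemma noiseFiltration_apply (hz : IsLevyProcess P z) (t : ℝ≥0) :
    noiseFiltration hz t
      = Filtration.natural z (fun t ↦ (hz.measurable t).stronglyMeasurable) t
        ⊔ MeasurableSpace.generateFrom {N : Set Ω | MeasurableSet N ∧ P N = 0} := by
  rw [noiseFiltration, Filtration.coeFn_sup]
  rfl

lemma measurable_noiseFiltration (hz : IsLevyProcess P z) (t : ℝ≥0) :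
    Measurable[noiseFiltration hz t] (z t) := by
  rw [noiseFiltration_apply]
  refine Measurable.mono (measurable_iff_comap_le.2 le_rfl) (le_sup_of_le_left ?_) le_rfl
  exact le_iSup₂_of_le (f := fun j (_ : j ≤ t) ↦ MeasurableSpace.comap (z j) _) t le_rfl le_rfl

lemma measurableSet_noiseFiltration_of_null (hz : IsLevyProcess P z) (t : ℝ≥0) {N : Set Ω}
    (hN : MeasurableSet N) (h0 : P N = 0) : MeasurableSet[noiseFiltration hz t] N := by
  rw [noiseFiltration_apply]
  exact (le_sup_right (a := (Filtration.natural z _) t)) N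
    (MeasurableSpace.measurableSet_generateFrom ⟨hN, h0⟩)

/-- An adapted process all of whose paths are càdlàg and start from `0`, and which almost surely
agrees with the given Lévy process at all times. -/
structure IsCadlagModification (hz : IsLevyProcess P z) (z' : ℝ≥0 → Ω → ℝ) : Prop where
  cadlag : ∀ ω, IsCadlag fun t ↦ z' t ω
  zero : ∀ ω, z' 0 ω = 0
  adapted : ∀ t, Measurable[noiseFiltration hz t] (z' t)
  ae_eq : ∀ᵐ ω ∂P, ∀ t, z' t ω = z t ω

/-- Set the path to zero on a measurable null set containing all bad sample points. That set lies in
every σ-algebra of the augmented filtration, so adaptedness survives. -/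
lemma exists_cadlag_modification (hz : IsLevyProcess P z) :
    ∃ z' : ℝ≥0 → Ω → ℝ, IsCadlagModification hz z' := by
  have hgood : ∀ᵐ ω ∂P, z 0 ω = 0 ∧ IsCadlag fun t ↦ z t ω := hz.zero.and hz.cadlag
  obtain ⟨N, hsub, hN, hN0⟩ := exists_measurable_superset_of_null (ae_iff.1 hgood)
  have hgood' : ∀ ω ∉ N, z 0 ω = 0 ∧ IsCadlag fun t ↦ z t ω := fun ω hω ↦ by
    by_contra h; exact hω (hsub h)
  refine ⟨fun t ↦ Nᶜ.indicator (z t), fun ω ↦ ?_, fun ω ↦ ?_, fun t ↦ ?_, ?_⟩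
  · by_cases hω : ω ∈ N
    · simpa [hω] using IsCadlag.of_continuous (continuous_const (y := (0 : ℝ)))
    · simpa [hω] using (hgood' ω hω).2
  · by_cases hω : ω ∈ N
    · simp [hω]
    · simpa [hω] using (hgood' ω hω).1
  · exact (measurable_noiseFiltration hz t).indicator
      (measurableSet_noiseFiltration_of_null hz t hN hN0).compl
  · filter_upwards [measure_eq_zero_iff_ae_notMem.1 hN0] with ω hω t
    simp [hω]

/-- Changing an event by a null set alters no probability, so augmenting the past does not destroy
independence. -/
lemma indep_eventuallyMeasurableSpace {m₁ m₂ : MeasurableSpace Ω} (h : Indep m₁ m₂ P) :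
    Indep (eventuallyMeasurableSpace m₁ (ae P)) m₂ P := by
  rw [Indep_iff] at h ⊢
  rintro A B ⟨A', hA', hAA'⟩ hB
  rw [measure_congr hAA', ← h A' B hA' hB]
  exact measure_congr (hAA'.inter (EventuallyEq.refl _ B))

lemma noiseFiltration_le_eventuallyMeasurableSpace (hz : IsLevyProcess P z) (t : ℝ≥0) :
    noiseFiltration hz t ≤ eventuallyMeasurableSpace
      (Filtration.natural z (fun t ↦ (hz.measurable t).stronglyMeasurable) t) (ae P) := by
  rw [noiseFiltration_apply]
  refine sup_le le_eventuallyMeasurableSpace (MeasurableSpace.generateFrom_le ?_)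
  rintro N ⟨_, hN0⟩
  exact ⟨∅, @MeasurableSet.empty Ω (Filtration.natural z
    (fun t ↦ (hz.measurable t).stronglyMeasurable) t), ae_eq_empty.2 hN0⟩

variable [IsProbabilityMeasure P]

/-- The increments after time `s` are independent of the past. -/
lemma indepFun_increments (hz : IsLevyProcess P z) (s : ℝ≥0) :
    IndepFun (fun ω (u : Set.Iic s) ↦ z u ω) (fun ω (u : ℝ≥0) ↦ z (s + u) ω - z s ω) P := by
  classical
  -- Almost surely `z 0 = 0`, so the past may also be written in increments.
  refine IndepFun.process_congr_left (X := fun (u : Set.Iic s) ω ↦ z u ω - z 0 ω) ?_ fun u ↦ by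
    filter_upwards [hz.zero] with ω hω
    simp [hω]
  refine IndepFun.process_indepFun_process
    (fun u ↦ (hz.measurable _).sub (hz.measurable _))
    (fun u ↦ (hz.measurable _).sub (hz.measurable _)) fun I J ↦ ?_
  obtain ⟨τ, hτ, hτ0, hτS⟩ := exists_monotone_enumeration
    (insert s (I.image Subtype.val ∪ J.image (fun u ↦ s + u)))
  obtain ⟨m, hm⟩ := hτS s (Finset.mem_insert_self _ _)
  have hI : ∀ u : I, ∃ k, k ≤ m ∧ τ k = (u : Set.Iic s) := fun u ↦ by
    obtain ⟨k, hk⟩ := hτS (u : Set.Iic s) (by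
      refine Finset.mem_insert_of_mem (Finset.mem_union_left _ ?_)
      exact Finset.mem_image_of_mem _ u.2)
    -- The grid can repeat values, so an index found for a past time may exceed `m`; clipping at `m`
    -- keeps past and future on disjoint index sets.
    refine ⟨min k m, min_le_right _ _, ?_⟩
    rw [hτ.map_min, hk, hm]
    exact min_eq_left u.1.2
  have hJ : ∀ u : J, ∃ k, m ≤ k ∧ τ k = s + u := fun u ↦ by
    obtain ⟨k, hk⟩ := hτS (s + u) (by
      refine Finset.mem_insert_of_mem (Finset.mem_union_right _ ?_)
      exact Finset.mem_image_of_mem _ u.2)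
    refine ⟨max k m, le_max_right _ _, ?_⟩
    rw [hτ.map_max, hk, hm]
    exact max_eq_left le_self_add
  choose p hpm hp using hI
  choose q hqm hq using hJ
  set n := Finset.univ.sup q with hn
  have hqn : ∀ u, q u ≤ n := fun u ↦ Finset.le_sup (Finset.mem_univ u)
  have hindep := (hz.indep.nat hτ).indepFun_finset (Finset.range m) (Finset.Ico m n)
    (by
      rw [Finset.disjoint_left]
      intro k hk hk'
      exact absurd (Finset.mem_Ico.1 hk').1 (not_le.2 (Finset.mem_range.1 hk)))
    (fun k ↦ (hz.measurable _).sub (hz.measurable _))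
  have h1 : (fun ω (u : I) ↦ z (u : Set.Iic s) ω - z 0 ω)
      = (fun (d : Finset.range m → ℝ) (u : I) ↦
          ∑ k : Finset.range m, if (k : ℕ) < p u then d k else 0)
        ∘ fun ω (k : Finset.range m) ↦ z (τ (k + 1)) ω - z (τ k) ω := by
    ext ω u
    simp only [Function.comp_apply]
    rw [← hp u, ← hτ0, sum_range_increments τ (Nat.zero_le _),
      Finset.sum_coe_sort (Finset.range m)
        (fun k ↦ if k < p u then z (τ (k + 1)) ω - z (τ k) ω else 0),
      ← Finset.sum_filter]
    refine Finset.sum_congr ?_ fun _ _ ↦ rfl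
    ext k
    have := hpm u
    simp only [Finset.mem_Ico, Finset.mem_filter, Finset.mem_range]
    omega
  have h2 : (fun ω (u : J) ↦ z (s + u) ω - z s ω)
      = (fun (d : Finset.Ico m n → ℝ) (u : J) ↦
          ∑ k : Finset.Ico m n, if (k : ℕ) < q u then d k else 0)
        ∘ fun ω (k : Finset.Ico m n) ↦ z (τ (k + 1)) ω - z (τ k) ω := by
    ext ω u
    simp only [Function.comp_apply]
    rw [← hq u, ← hm, sum_range_increments τ (hqm u),
      Finset.sum_coe_sort (Finset.Ico m n)
        (fun k ↦ if k < q u then z (τ (k + 1)) ω - z (τ k) ω else 0),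
      ← Finset.sum_filter]
    refine Finset.sum_congr ?_ fun _ _ ↦ rfl
    ext k
    have := hqn u
    simp only [Finset.mem_Ico, Finset.mem_filter]
    omega
  have hmeas : ∀ (S : Finset ℕ) (T : Type) (r : T → ℕ),
      Measurable fun (d : S → ℝ) (u : T) ↦ ∑ k : S, if (k : ℕ) < r u then d k else 0 := by
    intro S T r
    refine measurable_pi_lambda _ fun u ↦ Finset.measurable_sum _ fun k _ ↦ ?_
    split_ifs
    · exact measurable_pi_apply k
    · exact measurable_const
  rw [h1, h2]
  exact hindep.comp (hmeas _ _ _) (hmeas _ _ _)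

/-- The increments after time `s` have the law of the whole process. -/
lemma map_increments (hz : IsLevyProcess P z) (s : ℝ≥0) :
    P.map (fun ω (u : ℝ≥0) ↦ z (s + u) ω - z s ω) = P.map (fun ω (u : ℝ≥0) ↦ z u ω) := by
  classical
  have key : ∀ s : ℝ≥0, P.map (fun ω (u : ℝ≥0) ↦ z (s + u) ω - z s ω)
      = P.map (fun ω (u : ℝ≥0) ↦ z (0 + u) ω - z 0 ω) := fun s ↦ by
    have hmz : ∀ s, Measurable fun ω (u : ℝ≥0) ↦ z (s + u) ω - z s ω := fun s ↦
      measurable_pi_lambda _ fun u ↦ (hz.measurable _).sub (hz.measurable _)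
    refine (map_eq_iff_forall_finset_map_restrict_eq (X := fun u ω ↦ z (s + u) ω - z s ω)
      (Y := fun u ω ↦ z (0 + u) ω - z 0 ω) (hmz s).aemeasurable (hmz 0).aemeasurable).2
      fun J ↦ ?_
    obtain ⟨τ, hτ, hτ0, hτS⟩ := exists_monotone_enumeration J
    choose q hq using fun u : J ↦ hτS u u.2
    set n := Finset.univ.sup q with hn
    have hqn : ∀ u, q u ≤ n := fun u ↦ Finset.le_sup (Finset.mem_univ u)
    set D : ℝ≥0 → Ω → Fin n → ℝ := fun s ω k ↦ z (s + τ (k + 1)) ω - z (s + τ k) ω with hD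
    have hDm : ∀ s, Measurable (D s) := fun s ↦
      measurable_pi_lambda _ fun u ↦ (hz.measurable _).sub (hz.measurable _)
    -- By independence the grid increments have a product law, and by stationarity its factors
    -- depend only on the spacings, hence not on `s`.
    have hlaw : ∀ s, P.map (D s)
        = Measure.pi fun k : Fin n ↦ P.map (z (τ (k + 1) - τ k)) := fun s ↦ by
      have hmono : Monotone fun k ↦ s + τ k := fun a b hab ↦ add_le_add_right (hτ hab) s
      have h1 := ((hz.indep.nat hmono).precomp (g := fun k : Fin n ↦ (k : ℕ))
        Fin.val_injective).map_fun_eq_pi_map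
        (fun k ↦ ((hz.measurable _).sub (hz.measurable _)).aemeasurable)
      refine h1.trans ?_
      congr 1
      ext1 k
      have h2 := (hz.stationary (s + τ k) (τ (k + 1) - τ k)).map_eq
      rwa [add_assoc, add_tsub_cancel_of_le (hτ (Nat.le_succ _))] at h2
    set G : (Fin n → ℝ) → J → ℝ := fun d u ↦ ∑ k : Fin n, if (k : ℕ) < q u then d k else 0
      with hG
    have hGm : Measurable G := by
      refine measurable_pi_lambda _ fun u ↦ Finset.measurable_sum _ fun k _ ↦ ?_
      split_ifs
      · exact measurable_pi_apply k
      · exact measurable_const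
    have hGD : ∀ s, (fun ω ↦ J.restrict fun u ↦ z (s + u) ω - z s ω) = G ∘ D s := fun s ↦ by
      ext ω u
      simp only [Finset.restrict, Function.comp_apply, hG, hD]
      have h3 := sum_range_increments (z := fun r ↦ z (s + r)) τ (Nat.zero_le (q u)) ω
      simp only [hq u, hτ0, add_zero] at h3
      rw [h3, Fin.sum_univ_eq_sum_range
        (fun k ↦ if k < q u then z (s + τ (k + 1)) ω - z (s + τ k) ω else 0) n,
        ← Finset.sum_filter]
      refine Finset.sum_congr ?_ fun _ _ ↦ rfl
      ext k
      have := hqn u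
      simp only [Finset.mem_Ico, Finset.mem_filter, Finset.mem_range]
      omega
    rw [hGD, hGD, ← Measure.map_map hGm (hDm s), ← Measure.map_map hGm (hDm 0), hlaw, hlaw]
  rw [key s]
  refine Measure.map_congr ?_
  filter_upwards [hz.zero] with ω hω
  simp [hω]

/-- Any process that agrees with the increments after time `s` almost surely is independent of the
augmented filtration at time `s`. -/
lemma indep_noiseFiltration (hz : IsLevyProcess P z) (s : ℝ≥0) {W : Ω → ℝ≥0 → ℝ}
    (hW : (fun ω u ↦ z (s + u) ω - z s ω) =ᵐ[P] W) :
    Indep (noiseFiltration hz s) (MeasurableSpace.comap W inferInstance) P := by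
  have h1 := (indepFun_increments hz s).congr (EventuallyEq.refl _ _) hW
  rw [IndepFun_iff_Indep] at h1
  refine indep_of_indep_of_le_left (indep_eventuallyMeasurableSpace ?_)
    (noiseFiltration_le_eventuallyMeasurableSpace hz s)
  rwa [Filtration.natural_eq_comap]

end Noise

/-! ### The solution flow as a functional of the driving path -/

section Flow

/-- The embedding `a ↦ (a, 0)` of the line into the plane. -/
def embed (a : ℝ) : Plane := !₂[a, 0]

lemma continuous_embed : Continuous embed := by
  unfold embed
  fun_prop

lemma embed_sub (a b : ℝ) : embed (a - b) = embed a - embed b := by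
  ext i
  fin_cases i <;> simp [embed]

lemma embed_zero : embed 0 = 0 := by
  ext i
  fin_cases i <;> simp [embed]

/-- The planar path `s ↦ (v(s), 0)` on the real line. -/
def planarPath (v : ℝ≥0 → ℝ) (s : ℝ) : Plane := embed (v s.toNNReal)

lemma isRegularPath_planarPath {v : ℝ≥0 → ℝ} (hv : IsCadlag v) :
    IsRegularPath (planarPath v) :=
  (hv.continuous_comp continuous_embed).isRegularPath

/-- The drift `y ↦ A y + F y`. -/
def drift (l₁ l₂ : ℝ) (F : Plane → Plane) (y : Plane) : Plane := linDrift l₁ l₂ y + F y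

lemma exists_lipschitzWith_drift (l₁ l₂ : ℝ) {F : Plane → Plane}
    (hF : ∃ L : ℝ≥0, LipschitzWith L F) : ∃ K : ℝ≥0, LipschitzWith K (drift l₁ l₂ F) := by
  obtain ⟨L, hL⟩ := hF
  exact ⟨_, (linDrift l₁ l₂).lipschitz.add hL⟩

/-- The position at time `t` of the solution of `dX = b(X) dt + dv` started from `y`, as a limit
of Euler schemes, each depending on finitely many values of the driving path `v`. -/
def flow (b : Plane → Plane) (t : ℝ≥0) (y : Plane) (v : ℝ≥0 → ℝ) : Plane :=
  limUnder atTop (fun n : ℕ ↦ eulerScheme b (t / (n + 1)) y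
    (fun k ↦ planarPath v (k * (t / (n + 1)))) (n + 1)) + embed (v t)

variable {b : Plane → Plane} {K : ℝ≥0}

/-- This contains pathwise uniqueness: the left side does not mention `V`. -/
lemma flow_eq (hb : LipschitzWith K b) {v : ℝ≥0 → ℝ} (hv : IsCadlag v) {y : Plane}
    {V : ℝ → Plane} (hV : IsIntegralSol b y (planarPath v) V) (t : ℝ≥0) :
    flow b t y v = V t + embed (v t) := by
  rw [flow, (hV.tendsto_eulerScheme hb (isRegularPath_planarPath hv) t.coe_nonneg).limUnder_eq]

lemma exists_flow_eq (hb : LipschitzWith K b) {v : ℝ≥0 → ℝ} (hv : IsCadlag v) (y : Plane) :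
    ∃ V, IsIntegralSol b y (planarPath v) V ∧ ∀ t : ℝ≥0, flow b t y v = V t + embed (v t) := by
  obtain ⟨V, hV⟩ := exists_isIntegralSol hb y (isRegularPath_planarPath hv)
  exact ⟨V, hV, flow_eq hb hv hV⟩

lemma isCadlag_flow (hb : LipschitzWith K b) {v : ℝ≥0 → ℝ} (hv : IsCadlag v) (y : Plane) :
    IsCadlag fun t ↦ flow b t y v := by
  obtain ⟨V, hV, h⟩ := exists_flow_eq hb hv y
  simp_rw [h]
  exact (IsCadlag.of_continuous (hV.cont.comp NNReal.continuous_coe)).add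
    (hv.continuous_comp continuous_embed)

lemma flow_zero (hb : LipschitzWith K b) {v : ℝ≥0 → ℝ} (hv : IsCadlag v) (h0 : v 0 = 0)
    (y : Plane) : flow b 0 y v = y := by
  obtain ⟨V, hV, h⟩ := exists_flow_eq hb hv y
  rw [h, h0, embed_zero, NNReal.coe_zero, hV.eq 0 le_rfl]
  simp

/-- The flow property. -/
lemma flow_add (hb : LipschitzWith K b) {v : ℝ≥0 → ℝ} (hv : IsCadlag v) (y : Plane) (s t : ℝ≥0) :
    flow b (s + t) y v = flow b t (flow b s y v) (fun u ↦ v (s + u) - v s) := by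
  obtain ⟨V, hV, h⟩ := exists_flow_eq hb hv y
  have hv' : IsCadlag fun u ↦ v (s + u) - v s := fun u ↦ by
    obtain ⟨h1, l, hl⟩ := hv (s + u)
    refine ⟨(h1.comp (f := fun u ↦ s + u) (by fun_prop) fun r hr ↦ ?_).sub
      continuousWithinAt_const, l - v s, Tendsto.sub_const (hl.comp ?_) _⟩
    · exact add_le_add_right hr s
    · refine tendsto_nhdsWithin_iff.2 ⟨?_, ?_⟩
      · exact ((continuous_const.add continuous_id).tendsto u).mono_left nhdsWithin_le_nhds
      · filter_upwards [self_mem_nhdsWithin] with r hr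
        exact add_lt_add_right hr s
  have hshift := hV.shift hb (isRegularPath_planarPath hv) s.coe_nonneg
  -- The two driving paths agree only for `u ≥ 0`, since negative times are clipped; the solution
  -- property is therefore transferred through the integral over `[0, u]`.
  have hw : ∀ u : ℝ, 0 ≤ u → planarPath v (s + u) - planarPath v s
      = planarPath (fun u ↦ v (s + u) - v s) u := fun u hu ↦ by
    simp only [planarPath]
    rw [embed_sub, Real.toNNReal_add s.coe_nonneg hu, Real.toNNReal_coe]
  have hsol : IsIntegralSol b (flow b s y v) (planarPath fun u ↦ v (s + u) - v s)
      (fun u ↦ V (s + u) + embed (v s)) := by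
    have hs : planarPath v s = embed (v s) := by simp [planarPath]
    refine ⟨(hV.cont.comp (by fun_prop)).add continuous_const, fun u hu ↦ ?_⟩
    have h1 := hshift.eq u hu
    rw [hs] at h1
    rw [h, h1]
    congr 1
    refine intervalIntegral.integral_congr fun r hr ↦ ?_
    rw [Set.uIcc_of_le hu] at hr
    rw [← hw r hr.1, hs]
  rw [flow_eq hb hv' hsol, h, embed_sub, NNReal.coe_add]
  abel

/-- The flow is jointly measurable in the starting point and the driving path up to time `t`. -/
lemma measurable_flow (hb : Continuous b) {α : Type*} [MeasurableSpace α] {y : α → Plane}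
    {v : α → ℝ≥0 → ℝ} {t : ℝ≥0} (hy : Measurable y) (hv : ∀ s ≤ t, Measurable fun a ↦ v a s) :
    Measurable fun a ↦ flow b t (y a) (v a) := by
  refine Measurable.add ?_ (continuous_embed.measurable.comp (hv t le_rfl))
  refine StronglyMeasurable.measurable (StronglyMeasurable.limUnder fun n ↦
    Measurable.stronglyMeasurable ?_)
  have key : ∀ k ≤ n + 1, Measurable fun a ↦ eulerScheme b ((t : ℝ) / (n + 1)) (y a)
      (fun k ↦ planarPath (v a) (k * ((t : ℝ) / (n + 1)))) k := by
    intro k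
    induction k with
    | zero => exact fun _ ↦ hy
    | succ k ih =>
      intro hk
      have h1 := ih (by omega)
      -- Every sampling time is at most `t`, hence the flow looks at no later value of the path.
      have hle : (((k + 1 : ℕ) : ℝ) * ((t : ℝ) / (n + 1))).toNNReal ≤ t := by
        rw [Real.toNNReal_le_iff_le_coe, ← mul_div_assoc, div_le_iff₀ (by positivity), mul_comm]
        exact mul_le_mul_of_nonneg_left (by exact_mod_cast hk) t.coe_nonneg
      have h2 := hb.measurable.comp (h1.add (continuous_embed.measurable.comp (hv _ hle)))
      exact h1.add (h2.const_smul ((t : ℝ) / (n + 1)))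
  exact key (n + 1) le_rfl

end Flow

/-! ### Joint measurability and exchange of null sets -/

section Fubini

variable {Ω : Type*} [MeasurableSpace Ω] {P : Measure Ω}

/-- Moving the variable upper limit into an indicator makes this a parameter integral over a fixed
measure space. -/
lemma measurable_integral_uncurry {g : ℝ → Ω → Plane} (hg : Measurable (Function.uncurry g)) :
    Measurable fun p : ℝ≥0 × Ω ↦ ∫ s in (0 : ℝ)..p.1, g s p.2 := by
  have h1 : ∀ p : ℝ≥0 × Ω, ∫ s in (0 : ℝ)..p.1, g s p.2
      = ∫ s, {q : (ℝ≥0 × Ω) × ℝ | 0 < q.2 ∧ q.2 ≤ q.1.1}.indicator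
        (fun q ↦ g q.2 q.1.2) (p, s) := fun p ↦ by
    rw [intervalIntegral.integral_of_le p.1.coe_nonneg, ← integral_indicator measurableSet_Ioc]
    rfl
  simp_rw [h1]
  refine (StronglyMeasurable.integral_prod_right' (Measurable.stronglyMeasurable ?_)).measurable
  refine Measurable.indicator (hg.comp (measurable_snd.prodMk measurable_fst.snd)) ?_
  exact (measurableSet_lt measurable_const measurable_snd).inter
    (measurableSet_le measurable_snd measurable_fst.fst.coe_nnreal_real)

variable [SFinite P]

/-- Two jointly measurable processes that are versions of each other agree almost surely at almost
every time. -/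
lemma IsVersion.ae_ae_eq {X Y : ℝ≥0 → Ω → Plane} (h : IsVersion P X Y)
    (hX : Measurable (Function.uncurry X)) (hY : Measurable (Function.uncurry Y)) :
    ∀ᵐ ω ∂P, ∀ᵐ s : ℝ, X s.toNNReal ω = Y s.toNNReal ω := by
  have hr : Measurable fun p : ℝ × Ω ↦ (p.1.toNNReal, p.2) :=
    measurable_fst.real_toNNReal.prodMk measurable_snd
  rw [← Measure.ae_ae_comm (p := fun (s : ℝ) ω ↦ X s.toNNReal ω = Y s.toNNReal ω)
    (measurableSet_eq_fun (hX.comp hr) (hY.comp hr))]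
  exact Eventually.of_forall fun s ↦ h _

end Fubini

/-- Integer horizons suffice, so an almost sure statement needs only countably many null sets. On
negative times the integrand is constant. -/
lemma intervalIntegrable_toNNReal {f : ℝ≥0 → Plane}
    (h : ∀ n : ℕ, IntervalIntegrable (fun s : ℝ ↦ f s.toNNReal) volume 0 n) (a b : ℝ) :
    IntervalIntegrable (fun s : ℝ ↦ f s.toNNReal) volume a b := by
  obtain ⟨n, hn⟩ := exists_nat_ge (max |a| |b|)
  have h1 : IntervalIntegrable (fun s : ℝ ↦ f s.toNNReal) volume (-n) 0 := by
    refine (intervalIntegrable_const (c := f 0)).congr fun s hs ↦ ?_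
    rw [Set.uIoc_of_le (by simp)] at hs
    simp [Real.toNNReal_of_nonpos hs.2]
  refine (h1.trans (h n)).mono_set ?_
  have ha := abs_le.1 ((le_max_left _ _).trans hn)
  have hb := abs_le.1 ((le_max_right _ _).trans hn)
  rw [Set.uIcc_of_le (show -(n : ℝ) ≤ n by linarith [ha.1, ha.2])]
  exact Set.uIcc_subset_Icc ⟨ha.1, ha.2⟩ ⟨hb.1, hb.2⟩

/-! ### Solutions and mild solutions are stable under versions -/

section Transfer

variable {Ω : Type*} [MeasurableSpace Ω] {P : Measure Ω} [SFinite P] {z : ℝ≥0 → Ω → ℝ}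
  {l₁ l₂ : ℝ} {F : Plane → Plane} {x : Plane} {X Y : ℝ≥0 → Ω → Plane}

lemma IsVersion.symm {Ω : Type*} [MeasurableSpace Ω] {P : Measure Ω} {X Y : ℝ≥0 → Ω → Plane}
    (h : IsVersion P X Y) : IsVersion P Y X := fun t ↦ by
  filter_upwards [h t] with ω hω using hω.symm

lemma IsVersion.trans {Ω : Type*} [MeasurableSpace Ω] {P : Measure Ω}
    {X Y Z : ℝ≥0 → Ω → Plane} (h : IsVersion P X Y) (h' : IsVersion P Y Z) :
    IsVersion P X Z := fun t ↦ by
  filter_upwards [h t, h' t] with ω hω hω' using hω.trans hω'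

/-- Agreement at almost every time fixes the drift integral, and agreement at `t` fixes the left
side. -/
lemma IsSolution.of_isVersion (hY : IsSolution P z l₁ l₂ F x Y)
    (hX : Measurable (Function.uncurry X)) (h : IsVersion P X Y) :
    IsSolution P z l₁ l₂ F x X := by
  refine ⟨hX, fun t ↦ ?_⟩
  filter_upwards [h.ae_ae_eq hX hY.measurable, h t, hY.solves t] with ω h1 h2 ⟨h3, h4⟩
  have h5 : ∀ᵐ s : ℝ, linDrift l₁ l₂ (Y s.toNNReal ω) + F (Y s.toNNReal ω)
      = linDrift l₁ l₂ (X s.toNNReal ω) + F (X s.toNNReal ω) := by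
    filter_upwards [h1] with s hs
    rw [hs]
  refine ⟨h3.congr_ae (ae_restrict_of_ae h5), ?_⟩
  rw [h2, h4, intervalIntegral.integral_congr_ae (h5.mono fun _ hs _ ↦ hs)]

lemma IsMildSolution.of_isVersion (hY : IsMildSolution P z l₁ l₂ F x Y)
    (hX : Measurable (Function.uncurry X)) (h : IsVersion P X Y) :
    IsMildSolution P z l₁ l₂ F x X := by
  refine ⟨hX, fun t ↦ ?_⟩
  obtain ⟨I, hI, hYI⟩ := hY.mild t
  refine ⟨I, hI, ?_⟩
  filter_upwards [h.ae_ae_eq hX hY.measurable, h t, hYI] with ω h1 h2 ⟨h3, h4⟩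
  have h5 : ∀ᵐ s : ℝ, expDrift l₁ l₂ ((t : ℝ) - s) (F (Y s.toNNReal ω))
      = expDrift l₁ l₂ ((t : ℝ) - s) (F (X s.toNNReal ω)) := by
    filter_upwards [h1] with s hs
    rw [hs]
  refine ⟨h3.congr_ae (ae_restrict_of_ae h5), ?_⟩
  rw [h2, h4, intervalIntegral.integral_congr_ae (h5.mono fun _ hs _ ↦ hs)]

end Transfer

/-! ### The stochastic convolution -/

section StochIntegral

variable {Ω : Type*} [MeasurableSpace Ω] {P : Measure Ω}

lemma measurable_noise {z : ℝ≥0 → Ω → ℝ} (hz : ∀ t, Measurable (z t)) (t : ℝ≥0) :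
    Measurable (noise z t) :=
  continuous_embed.measurable.comp (hz t)

/-- The stochastic convolution, expressed pathwise. -/
def stochConv (l₁ l₂ : ℝ) (v : ℝ≥0 → ℝ) (t : ℝ≥0) : Plane :=
  embed (v t) + ∫ s in (0 : ℝ)..t,
    expDrift l₁ l₂ ((t : ℝ) - s) (linDrift l₁ l₂ (planarPath v s))

lemma hasDerivAt_expDrift_sub (l₁ l₂ t s : ℝ) :
    HasDerivAt (fun s : ℝ ↦ expDrift l₁ l₂ (t - s))
      (-(expDrift l₁ l₂ (t - s) * linDrift l₁ l₂)) s := by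
  have := (hasDerivAt_exp_smul_const (linDrift l₁ l₂) (t - s)).scomp s
    ((hasDerivAt_id s).const_sub t)
  simpa [Function.comp_def, expDrift] using this

lemma expDrift_zero (l₁ l₂ : ℝ) : expDrift l₁ l₂ 0 = 1 :=
  exp_zero_smul (linDrift l₁ l₂)

lemma continuous_expDrift (l₁ l₂ : ℝ) : Continuous (expDrift l₁ l₂) :=
  continuous_exp_smul (linDrift l₁ l₂)

variable [IsProbabilityMeasure P] {z z' : ℝ≥0 → Ω → ℝ} {hz : IsLevyProcess P z}
  {l₁ l₂ : ℝ}

/-- Summation by parts with `Φ(s) = e^{A(t-s)}`: here `Φ(t) = 1`, the path starts at `0`, and `-Φ' =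
e^{A(t-s)} A`. The Riemann sums converge almost surely, hence in probability. -/
lemma isStochIntegral_stochConv (hz' : IsCadlagModification hz z') (l₁ l₂ : ℝ) (t : ℝ≥0) :
    IsStochIntegral P (fun s ↦ expDrift l₁ l₂ ((t : ℝ) - s)) (noise z) t
      (fun ω ↦ stochConv l₁ l₂ (fun u ↦ z' u ω) t) := by
  intro N τ hmono h0 ht hmesh
  refine tendstoInMeasure_of_tendsto_ae (fun k ↦ ?_) ?_
  · refine (Finset.measurable_sum _ fun i _ ↦ ?_).aestronglyMeasurable
    exact (ContinuousLinearMap.measurable _).comp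
      ((measurable_noise hz.measurable _).sub (measurable_noise hz.measurable _))
  · filter_upwards [hz'.ae_eq] with ω hω
    have hcont : Continuous fun s : ℝ ↦ -(expDrift l₁ l₂ ((t : ℝ) - s) * linDrift l₁ l₂) :=
      (((continuous_expDrift l₁ l₂).comp (by fun_prop)).mul continuous_const).neg
    have h1 := tendsto_sum_clm_apply_sub (isRegularPath_planarPath (hz'.cadlag ω))
      (hasDerivAt_expDrift_sub l₁ l₂ t) hcont (t := t) (N := N) (τ := fun k i ↦ (τ k i : ℝ))
      (fun k ↦ NNReal.coe_mono.comp (hmono k)) (fun k ↦ by simp [h0]) (fun k ↦ by rw [ht])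
      (fun δ hδ ↦ by
        filter_upwards [hmesh ⟨δ, hδ.le⟩ (by exact_mod_cast hδ)] with k hk i hi
        exact_mod_cast hk i hi)
    have h2 : ∀ u : ℝ≥0, planarPath (fun u ↦ z' u ω) u = noise z u ω := fun u ↦ by
      simp [planarPath, embed, noise, hω]
    simp only [h2] at h1
    have h3 : planarPath (fun u ↦ z' u ω) 0 = 0 := by
      simp [planarPath, hz'.zero, embed_zero]
    have h4 : embed (z' t ω) = noise z t ω := by rw [hω]; rfl
    convert h1 using 2
    rw [stochConv, h3, h4, sub_self, map_zero, sub_zero, expDrift_zero,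
      one_apply_eq_self, sub_eq_add_neg, ← intervalIntegral.integral_neg]
    simp

/-- Limits in probability are unique, so testing along the equipartitions of `[0, t]` is enough. -/
lemma IsStochIntegral.ae_eq_stochConv (hz' : IsCadlagModification hz z') {t : ℝ≥0}
    {I : Ω → Plane}
    (hI : IsStochIntegral P (fun s ↦ expDrift l₁ l₂ ((t : ℝ) - s)) (noise z) t I) :
    I =ᵐ[P] fun ω ↦ stochConv l₁ l₂ (fun u ↦ z' u ω) t := by
  set τ : ℕ → ℕ → ℝ≥0 := fun k i ↦ i * (t / (k + 1)) with hτ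
  have hmono : ∀ k, Monotone (τ k) := fun k i j hij ↦
    mul_le_mul_of_nonneg_right (by exact_mod_cast hij) zero_le
  have h0 : ∀ k, τ k 0 = 0 := fun k ↦ by simp [hτ]
  have ht : ∀ k, τ k (k + 1) = t := fun k ↦ by
    simp only [hτ]
    push_cast
    exact mul_div_cancel₀ _ (by positivity)
  have hmesh : ∀ δ : ℝ≥0, 0 < δ → ∀ᶠ k in atTop, ∀ i < k + 1, τ k (i + 1) < τ k i + δ := by
    intro δ hδ
    have h1 : Tendsto (fun k : ℕ ↦ t * (1 / ((k : ℝ≥0) + 1))) atTop (𝓝 (t * 0)) :=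
      (tendsto_one_div_add_atTop_nhds_zero_nat (𝕜 := ℝ≥0)).const_mul t
    rw [mul_zero] at h1
    filter_upwards [h1.eventually_lt_const hδ] with k hk i _
    rw [mul_one_div] at hk
    simp only [hτ]
    push_cast
    rw [add_mul, one_mul]
    exact add_lt_add_right hk _
  exact tendstoInMeasure_ae_unique (u := atTop) (hI (fun k ↦ k + 1) τ hmono h0 ht hmesh)
    (isStochIntegral_stochConv hz' l₁ l₂ t (fun k ↦ k + 1) τ hmono h0 ht hmesh)

end StochIntegral

/-! ### The canonical solution; uniqueness of solutions and mild solutions -/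

section

variable {Ω : Type*} [mΩ : MeasurableSpace Ω] {P : Measure Ω} {z z' : ℝ≥0 → Ω → ℝ}
  {hz : IsLevyProcess P z} {l₁ l₂ : ℝ} {F : Plane → Plane} {x : Plane} {X : ℝ≥0 → Ω → Plane}

/-- The solution driven by the càdlàg modification `z'` of the noise. -/
def canonicalSol (b : Plane → Plane) (z' : ℝ≥0 → Ω → ℝ) (x : Plane) (t : ℝ≥0) (ω : Ω) : Plane :=
  flow b t x fun u ↦ z' u ω

namespace IsCadlagModification

lemma measurable (hz' : IsCadlagModification hz z') (t : ℝ≥0) : Measurable (z' t) :=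
  (hz'.adapted t).mono ((noiseFiltration hz).le t) le_rfl

lemma isRegularPath (hz' : IsCadlagModification hz z') (ω : Ω) :
    IsRegularPath (planarPath fun u ↦ z' u ω) :=
  isRegularPath_planarPath (hz'.cadlag ω)

lemma measurable_planarPath (hz' : IsCadlagModification hz z') :
    Measurable (Function.uncurry fun s ω ↦ planarPath (fun u ↦ z' u ω) s) :=
  measurable_uncurry_of_rightCts (fun _ ↦ continuous_embed.measurable.comp (hz'.measurable _))
    (fun ω s ↦ (hz'.isRegularPath ω).rightCts s)

lemma measurable_embed (hz' : IsCadlagModification hz z') :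
    Measurable fun p : ℝ≥0 × Ω ↦ embed (z' p.1 p.2) := by
  have := hz'.measurable_planarPath.comp
    ((measurable_fst.coe_nnreal_real.prodMk measurable_snd) :
      Measurable fun p : ℝ≥0 × Ω ↦ ((p.1 : ℝ), p.2))
  simpa [Function.comp_def, Function.uncurry, planarPath] using this

lemma adapted_canonicalSol (hz' : IsCadlagModification hz z') {b : Plane → Plane}
    (hb : Continuous b) (x : Plane) : Adapted (noiseFiltration hz) (canonicalSol b z' x) :=
  fun t ↦ @measurable_flow b hb Ω (noiseFiltration hz t) _ _ t measurable_const
    fun s hs ↦ (hz'.adapted s).mono ((noiseFiltration hz).mono hs) le_rfl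

lemma measurable_canonicalSol (hz' : IsCadlagModification hz z') {b : Plane → Plane} {K : ℝ≥0}
    (hb : LipschitzWith K b) (x : Plane) : Measurable (Function.uncurry (canonicalSol b z' x)) := by
  have h1 := measurable_uncurry_of_rightCts
    (f := fun (s : ℝ) ω ↦ canonicalSol b z' x s.toNNReal ω)
    (fun s ↦ (hz'.adapted_canonicalSol hb.continuous x _).mono ((noiseFiltration hz).le _) le_rfl)
    (fun ω s ↦ (isCadlag_flow hb (hz'.cadlag ω) x).isRegularPath.rightCts s)
  have := h1.comp ((measurable_fst.coe_nnreal_real.prodMk measurable_snd) :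
      Measurable fun p : ℝ≥0 × Ω ↦ ((p.1 : ℝ), p.2))
  simpa [Function.comp_def, Function.uncurry_def] using this

end IsCadlagModification

variable {K : ℝ≥0}

/-- Driven by `z'` the equation has no exceptional set; one null set, common to all times, enters
when `z'` is replaced by `z`. -/
lemma solvesAt_canonicalSol (hz' : IsCadlagModification hz z')
    (hb : LipschitzWith K (drift l₁ l₂ F)) (x : Plane) (t : ℝ≥0) (ω : Ω) :
    SolvesAt z' l₁ l₂ F x (canonicalSol (drift l₁ l₂ F) z' x) t ω := by
  obtain ⟨V, hV, h⟩ := exists_flow_eq hb (hz'.cadlag ω) x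
  refine ⟨((isCadlag_flow hb (hz'.cadlag ω) x).isRegularPath.lipschitz_comp
    hb).intervalIntegrable _ _, ?_⟩
  change flow _ _ _ _ = _
  rw [h, hV.eq t t.coe_nonneg]
  congr 2
  refine intervalIntegral.integral_congr fun s hs ↦ ?_
  rw [Set.uIcc_of_le t.coe_nonneg] at hs
  change _ = drift l₁ l₂ F (flow _ _ _ _)
  rw [h, Real.coe_toNNReal s hs.1]
  rfl

lemma isStrongSolution_canonicalSol (hz' : IsCadlagModification hz z')
    (hb : LipschitzWith K (drift l₁ l₂ F)) (x : Plane) :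
    IsStrongSolution hz l₁ l₂ F x (canonicalSol (drift l₁ l₂ F) z' x) where
  measurable := hz'.measurable_canonicalSol hb x
  solves t := by
    filter_upwards [hz'.ae_eq] with ω hω
    obtain ⟨h1, h2⟩ := solvesAt_canonicalSol hz' hb x t ω
    refine ⟨h1, h2.trans ?_⟩
    rw [noise, hω, noise]
  adapted := hz'.adapted_canonicalSol hb.continuous x

/-- Any solution is a version of the canonical one. -/
theorem IsSolution.isVersion_canonicalSol [SFinite P] (hz' : IsCadlagModification hz z')
    (hb : LipschitzWith K (drift l₁ l₂ F)) (hX : IsSolution P z l₁ l₂ F x X) :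
    IsVersion P X (canonicalSol (drift l₁ l₂ F) z' x) := by
  set b := drift l₁ l₂ F with hbdef
  set g : ℝ → Ω → Plane := fun s ω ↦ b (X s.toNNReal ω) with hg
  have hgm : Measurable (Function.uncurry g) := hb.continuous.measurable.comp
    (hX.measurable.comp (measurable_fst.real_toNNReal.prodMk measurable_snd))
  -- Insert `X` into its own equation: the resulting version differs from the noise by a primitive,
  -- which is continuous wherever the drift is locally integrable.
  set Y : ℝ≥0 → Ω → Plane := fun t ω ↦ x + (∫ s in (0 : ℝ)..t, g s ω) + embed (z' t ω) with hY
  have hYm : Measurable (Function.uncurry Y) :=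
    ((measurable_integral_uncurry hgm).const_add x).add hz'.measurable_embed
  have hXY : IsVersion P X Y := fun t ↦ by
    filter_upwards [hX.solves t, hz'.ae_eq] with ω ⟨_, h2⟩ hω
    simp only [hY]
    rw [h2, hω]
    rfl
  have hint : ∀ᵐ ω ∂P, ∀ n : ℕ, IntervalIntegrable (fun s ↦ g s ω) volume 0 n :=
    ae_all_iff.2 fun n ↦ (hX.solves n).mono fun ω h ↦ by
      have h1 := h.1
      rwa [NNReal.coe_natCast] at h1
  intro t
  filter_upwards [hXY t, hXY.ae_ae_eq hX.measurable hYm, hint] with ω h1 h2 h3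
  have hI : ∀ c d, IntervalIntegrable (fun s ↦ g s ω) volume c d :=
    intervalIntegrable_toNNReal (f := fun s ↦ b (X s ω)) h3
  set V : ℝ → Plane := fun r ↦ x + ∫ s in (0 : ℝ)..r.toNNReal, g s ω with hV
  have hVc : Continuous V := continuous_const.add
    ((intervalIntegral.continuous_primitive hI 0).comp (by fun_prop))
  -- For almost every `ω`, `X = Y` at almost every time, so `X` may be replaced by `V + w` under the
  -- integral; the equation then holds for all `r ≥ 0`.
  have hsol : IsIntegralSol b x (planarPath fun u ↦ z' u ω) V := by
    refine ⟨hVc, fun r hr ↦ ?_⟩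
    simp only [hV]
    rw [Real.coe_toNNReal r hr]
    congr 1
    refine intervalIntegral.integral_congr_ae ?_
    filter_upwards [h2] with s hs _
    simp only [hg]
    rw [hs]
    rfl
  rw [h1, canonicalSol, flow_eq hb (hz'.cadlag ω) hsol]
  simp [hY, hV]

/-- The pathwise mild formula for the integral equation. -/
lemma isIntegralSol_drift_iff {L : ℝ≥0} (hF : LipschitzWith L F) {w V : ℝ → Plane}
    (hw : IsRegularPath w) (hV : Continuous V) :
    IsIntegralSol (drift l₁ l₂ F) x w V ↔ ∀ t, 0 ≤ t → V t = expDrift l₁ l₂ t x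
      + ∫ s in (0 : ℝ)..t, expDrift l₁ l₂ (t - s) (F (V s + w s) + linDrift l₁ l₂ (w s)) := by
  have hG : IsRegularPath fun s ↦ F (V s + w s) + linDrift l₁ l₂ (w s) :=
    (((IsRegularPath.of_continuous hV).add hw).lipschitz_comp hF).add
      (hw.lipschitz_comp (linDrift l₁ l₂).lipschitz)
  have h1 : ∀ s, drift l₁ l₂ F (V s + w s)
      = linDrift l₁ l₂ (V s) + (F (V s + w s) + linDrift l₁ l₂ (w s)) := fun s ↦ by
    rw [drift, map_add]; abel
  refine Iff.trans ?_ (integral_eq_iff_mild (linDrift l₁ l₂) x hG hV)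
  simp_rw [← h1]
  exact ⟨fun h ↦ h.eq, fun h ↦ ⟨hV, h⟩⟩

/-- The forcing of `V` is `F(X) + A w`. The convolution of `A w`, together with the `w(t)` restored
in `X = V + w`, is exactly `stochConv`. -/
lemma isMildSolution_canonicalSol [IsProbabilityMeasure P] (hz' : IsCadlagModification hz z')
    {L : ℝ≥0} (hF : LipschitzWith L F) (hb : LipschitzWith K (drift l₁ l₂ F)) (x : Plane) :
    IsMildSolution P z l₁ l₂ F x (canonicalSol (drift l₁ l₂ F) z' x) where
  measurable := hz'.measurable_canonicalSol hb x
  mild t := by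
    refine ⟨_, isStochIntegral_stochConv hz' l₁ l₂ t, Eventually.of_forall fun ω ↦ ?_⟩
    obtain ⟨V, hV, h⟩ := exists_flow_eq hb (hz'.cadlag ω) x
    have hw := hz'.isRegularPath ω
    have hS : Continuous fun s : ℝ ↦ expDrift l₁ l₂ ((t : ℝ) - s) :=
      (continuous_expDrift l₁ l₂).comp (by fun_prop)
    have hI1 := (((isCadlag_flow hb (hz'.cadlag ω) x).isRegularPath.lipschitz_comp hF).clm_apply
      hS).intervalIntegrable 0 t
    have hI2 := ((hw.lipschitz_comp (linDrift l₁ l₂).lipschitz).clm_apply hS).intervalIntegrable 0 t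
    refine ⟨hI1, ?_⟩
    have hsplit : ∫ s in (0 : ℝ)..t, expDrift l₁ l₂ (t - s)
          (F (V s + planarPath (fun u ↦ z' u ω) s) + linDrift l₁ l₂ (planarPath (fun u ↦ z' u ω) s))
        = (∫ s in (0 : ℝ)..t, expDrift l₁ l₂ (t - s)
            (F (canonicalSol (drift l₁ l₂ F) z' x s.toNNReal ω)))
          + ∫ s in (0 : ℝ)..t, expDrift l₁ l₂ (t - s)
            (linDrift l₁ l₂ (planarPath (fun u ↦ z' u ω) s)) := by
      refine Eq.trans ?_ (intervalIntegral.integral_add hI1 hI2)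
      refine intervalIntegral.integral_congr fun s hs ↦ ?_
      rw [Set.uIcc_of_le t.coe_nonneg] at hs
      simp only [map_add, canonicalSol, h, Real.coe_toNNReal s hs.1]
      rfl
    rw [canonicalSol, h, (isIntegralSol_drift_iff hF hw hV.cont).1 hV t t.coe_nonneg, stochConv,
      hsplit]
    abel

/-- Any mild solution is a version of the canonical one. -/
theorem IsMildSolution.isVersion_canonicalSol [IsProbabilityMeasure P]
    (hz' : IsCadlagModification hz z') {L : ℝ≥0} (hF : LipschitzWith L F)
    (hF_bdd : ∃ C : ℝ, ∀ y, ‖F y‖ ≤ C) (hb : LipschitzWith K (drift l₁ l₂ F))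
    (hX : IsMildSolution P z l₁ l₂ F x X) :
    IsVersion P X (canonicalSol (drift l₁ l₂ F) z' x) := by
  obtain ⟨C, hC⟩ := hF_bdd
  set S : ℝ → Plane →L[ℝ] Plane := expDrift l₁ l₂ with hS
  have hSc : Continuous S := continuous_expDrift l₁ l₂
  have hFX : Measurable fun p : ℝ × Ω ↦ F (X p.1.toNNReal p.2) := hF.continuous.measurable.comp
    (hX.measurable.comp (measurable_fst.real_toNNReal.prodMk measurable_snd))
  have hAw : Measurable fun p : ℝ × Ω ↦ linDrift l₁ l₂ (planarPath (fun u ↦ z' u p.2) p.1) :=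
    (linDrift l₁ l₂).continuous.measurable.comp hz'.measurable_planarPath
  set q : ℝ → Ω → Plane := fun s ω ↦
    S (-s) (F (X s.toNNReal ω) + linDrift l₁ l₂ (planarPath (fun u ↦ z' u ω) s)) with hq
  have happ : Measurable fun p : (Plane →L[ℝ] Plane) × Plane ↦ p.1 p.2 :=
    (isBoundedBilinearMap_apply (𝕜 := ℝ) (E := Plane) (F := Plane)).continuous.measurable
  have hqm : Measurable (Function.uncurry q) :=
    happ.comp ((hSc.measurable.comp measurable_fst.neg).prodMk (hFX.add hAw))
  -- Boundedness of `F` gives integrability for every `ω`, with no regularity of the paths of `X`.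
  have hFI : ∀ (ω : Ω) (Φ : ℝ → Plane →L[ℝ] Plane), Continuous Φ → ∀ c d,
      IntervalIntegrable (fun s ↦ Φ s (F (X s.toNNReal ω))) volume c d := by
    intro ω Φ hΦ c d
    have hm : Measurable fun s ↦ Φ s (F (X s.toNNReal ω)) :=
      happ.comp (hΦ.measurable.prodMk (hFX.comp (measurable_id.prodMk measurable_const)))
    have key : ∀ c d : ℝ, IntegrableOn (fun s ↦ Φ s (F (X s.toNNReal ω))) (Set.Ioc c d) volume := by
      intro c d
      obtain ⟨M, hM⟩ := bounded_of_continuous hΦ c d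
      refine Measure.integrableOn_of_bounded (M := M * C) (by simp) hm.aestronglyMeasurable ?_
      filter_upwards [ae_restrict_mem measurableSet_Ioc] with s hs
      have h1 := hM s ⟨hs.1.le, hs.2⟩
      exact ((Φ s).le_opNorm _).trans
        (mul_le_mul h1 (hC _) (norm_nonneg _) ((norm_nonneg _).trans h1))
    exact ⟨key c d, key d c⟩
  have hwI : ∀ (ω : Ω) (Φ : ℝ → Plane →L[ℝ] Plane), Continuous Φ → ∀ c d, IntervalIntegrable
      (fun s ↦ Φ s (linDrift l₁ l₂ (planarPath (fun u ↦ z' u ω) s))) volume c d :=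
    fun ω Φ hΦ c d ↦ (((hz'.isRegularPath ω).lipschitz_comp
      (linDrift l₁ l₂).lipschitz).clm_apply hΦ).intervalIntegrable c d
  have hqI : ∀ ω c d, IntervalIntegrable (fun s ↦ q s ω) volume c d := fun ω c d ↦ by
    simp only [hq, map_add]
    exact (hFI ω _ (hSc.comp continuous_neg) c d).add (hwI ω _ (hSc.comp continuous_neg) c d)
  have hexp : ∀ t s, S (t - s) = S t * S (-s) := fun t s ↦ exp_sub_smul (linDrift l₁ l₂) t s
  -- The version given by the mild formula, with `e^{tA}` factored out so that its part without
  -- noise is visibly continuous in `t`.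
  set Y : ℝ≥0 → Ω → Plane := fun t ω ↦
    S t (x + ∫ s in (0 : ℝ)..t, q s ω) + embed (z' t ω) with hY
  have hYm : Measurable (Function.uncurry Y) :=
    (happ.comp ((hSc.measurable.comp measurable_fst.coe_nnreal_real).prodMk
      ((measurable_integral_uncurry hqm).const_add x))).add hz'.measurable_embed
  have hXY : IsVersion P X Y := fun t ↦ by
    obtain ⟨I, hI, hXI⟩ := hX.mild t
    filter_upwards [hI.ae_eq_stochConv hz', hXI] with ω h1 ⟨_, h2⟩
    have h3 : S t (∫ s in (0 : ℝ)..t, q s ω) = (∫ s in (0 : ℝ)..t, S (t - s) (F (X s.toNNReal ω)))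
        + ∫ s in (0 : ℝ)..t,
          S (t - s) (linDrift l₁ l₂ (planarPath (fun u ↦ z' u ω) s)) := by
      rw [← ContinuousLinearMap.intervalIntegral_comp_comm _ (hqI ω 0 t),
        ← intervalIntegral.integral_add (hFI ω (fun s ↦ S (t - s)) (hSc.comp (by fun_prop)) 0 t)
          (hwI ω (fun s ↦ S (t - s)) (hSc.comp (by fun_prop)) 0 t)]
      simp_rw [hexp]
      simp [hq]
    simp only [hY]
    rw [h2, h1, map_add, h3, stochConv]
    abel
  intro t
  filter_upwards [hXY t, hXY.ae_ae_eq hX.measurable hYm] with ω h1 h2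
  have hw := hz'.isRegularPath ω
  set V : ℝ → Plane := fun r ↦ S r.toNNReal (x + ∫ s in (0 : ℝ)..r.toNNReal, q s ω) with hV
  have hVc : Continuous V := (hSc.comp (by fun_prop)).clm_apply
    (continuous_const.add
      ((intervalIntegral.continuous_primitive (hqI ω) 0).comp (by fun_prop)))
  have hsol : IsIntegralSol (drift l₁ l₂ F) x (planarPath fun u ↦ z' u ω) V := by
    refine (isIntegralSol_drift_iff hF hw hVc).2 fun r hr ↦ ?_
    have hG : IsRegularPath fun s ↦ F (V s + planarPath (fun u ↦ z' u ω) s)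
        + linDrift l₁ l₂ (planarPath (fun u ↦ z' u ω) s) :=
      (((IsRegularPath.of_continuous hVc).add hw).lipschitz_comp hF).add
        (hw.lipschitz_comp (linDrift l₁ l₂).lipschitz)
    refine Eq.trans ?_ (congrArg (S r x + ·) (integral_exp_sub_smul (linDrift l₁ l₂) hG r).symm)
    simp only [hV]
    rw [Real.coe_toNNReal r hr, map_add]
    congr 2
    refine intervalIntegral.integral_congr_ae ?_
    filter_upwards [h2] with s hs _
    simp only [hq]
    rw [hs]
    rfl
  rw [h1, canonicalSol, flow_eq hb (hz'.cadlag ω) hsol]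
  simp [hY, hV]

end

/-! ### Transition kernels and the Markov property -/

section

variable {Ω : Type*} [mΩ : MeasurableSpace Ω] {P : Measure Ω}
  {z z' : ℝ≥0 → Ω → ℝ} {hz : IsLevyProcess P z} {b : Plane → Plane} {K : ℝ≥0}

lemma measurable_canonicalSol_uncurry (hz' : IsCadlagModification hz z') (hb : Continuous b)
    (t : ℝ≥0) : Measurable fun p : Plane × Ω ↦ canonicalSol b z' p.1 t p.2 :=
  measurable_flow hb measurable_fst fun s _ ↦ (hz'.measurable s).comp measurable_snd

lemma measurable_canonicalSol_apply (hz' : IsCadlagModification hz z') (hb : Continuous b)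
    (y : Plane) (t : ℝ≥0) : Measurable (canonicalSol b z' y t) :=
  (hz'.adapted_canonicalSol hb y t).mono ((noiseFiltration hz).le t) le_rfl

/-- The transition kernels of the solution flow. -/
def transitionKernel (P : Measure Ω) (b : Plane → Plane) (z' : ℝ≥0 → Ω → ℝ) (t : ℝ≥0) :
    Kernel Plane Plane :=
  (Kernel.id ×ₖ Kernel.const Plane P).map fun p ↦ canonicalSol b z' p.1 t p.2

variable [IsProbabilityMeasure P]

lemma transitionKernel_apply (hz' : IsCadlagModification hz z') (hb : Continuous b)
    (t : ℝ≥0) (y : Plane) :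
    transitionKernel P b z' t y = P.map (canonicalSol b z' y t) := by
  have hm := measurable_canonicalSol_uncurry hz' hb t
  rw [transitionKernel, Kernel.map_apply _ hm, Kernel.prod_apply, Kernel.id_apply,
    Kernel.const_apply, Measure.dirac_prod, Measure.map_map hm measurable_prodMk_left]
  rfl

lemma isMarkovKernel_transitionKernel (hz' : IsCadlagModification hz z') (hb : Continuous b)
    (t : ℝ≥0) : IsMarkovKernel (transitionKernel P b z' t) :=
  Kernel.IsMarkovKernel.map _ (measurable_canonicalSol_uncurry hz' hb t)

lemma map_increments_modification (hz' : IsCadlagModification hz z') (s : ℝ≥0) :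
    P.map (fun ω (u : ℝ≥0) ↦ z' (s + u) ω - z' s ω) = P.map (fun ω (u : ℝ≥0) ↦ z' u ω) := by
  have h1 : (fun ω (u : ℝ≥0) ↦ z' (s + u) ω - z' s ω) =ᵐ[P]
      fun ω (u : ℝ≥0) ↦ z (s + u) ω - z s ω := by
    filter_upwards [hz'.ae_eq] with ω hω
    simp [hω]
  have h2 : (fun ω (u : ℝ≥0) ↦ z' u ω) =ᵐ[P] fun ω (u : ℝ≥0) ↦ z u ω := by
    filter_upwards [hz'.ae_eq] with ω hω
    simp [hω]
  rw [Measure.map_congr h1, Measure.map_congr h2, map_increments hz]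

/-- The Markov property of the canonical solution, integrated over events of the past. -/
lemma measure_inter_canonicalSol_add (hz' : IsCadlagModification hz z') (hb : LipschitzWith K b)
    (x : Plane) (s t : ℝ≥0) {A : Set Ω} (hA : MeasurableSet[noiseFiltration hz s] A)
    {B : Set Plane} (hB : MeasurableSet B) :
    P (A ∩ canonicalSol b z' x (s + t) ⁻¹' B)
      = ∫⁻ ω in A, transitionKernel P b z' t (canonicalSol b z' x s ω) B ∂P := by
  set W : Ω → ℝ≥0 → ℝ := fun ω u ↦ z' (s + u) ω - z' s ω with hW
  have hWm : Measurable W :=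
    measurable_pi_lambda _ fun u ↦ (hz'.measurable _).sub (hz'.measurable _)
  -- Carrying the indicator of `A` along with the state at time `s` puts all the relevant past in
  -- one random variable, so independence of the single pair `(Y, W)` suffices.
  set Y : Ω → ℝ × Plane := fun ω ↦ (A.indicator 1 ω, canonicalSol b z' x s ω) with hY
  have hYs : Measurable[noiseFiltration hz s] Y :=
    Measurable.prodMk
      ((@measurable_const ℝ Ω _ (noiseFiltration hz s) 1).indicator hA)
      (hz'.adapted_canonicalSol hb.continuous x s)
  have hYm : Measurable Y := hYs.mono ((noiseFiltration hz).le s) le_rfl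
  have hAm : MeasurableSet A := (noiseFiltration hz).le s A hA
  have hindep : IndepFun Y W P := by
    rw [IndepFun_iff_Indep]
    refine indep_of_indep_of_le_left (indep_noiseFiltration hz s ?_) hYs.comap_le
    filter_upwards [hz'.ae_eq] with ω hω
    simp [hW, hω]
  have hprod := (indepFun_iff_map_prod_eq_prod_map_map hYm.aemeasurable hWm.aemeasurable).1 hindep
  have hfl : Measurable fun p : (ℝ × Plane) × (ℝ≥0 → ℝ) ↦ flow b t p.1.2 p.2 :=
    measurable_flow hb.continuous measurable_fst.snd
      fun u _ ↦ (measurable_pi_apply u).comp measurable_snd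
  set C : Set ((ℝ × Plane) × (ℝ≥0 → ℝ)) := {p | p.1.1 = 1 ∧ flow b t p.1.2 p.2 ∈ B} with hC
  have hCm : MeasurableSet C :=
    (measurableSet_eq_fun measurable_fst.fst measurable_const).inter (hfl hB)
  have h1 : A ∩ canonicalSol b z' x (s + t) ⁻¹' B = (fun ω ↦ (Y ω, W ω)) ⁻¹' C := by
    ext ω
    have h2 : canonicalSol b z' x (s + t) ω = flow b t (canonicalSol b z' x s ω) (W ω) :=
      flow_add hb (hz'.cadlag ω) x s t
    by_cases hω : ω ∈ A <;> simp [hC, hY, hω, h2]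
  have hpath : Measurable fun ω (u : ℝ≥0) ↦ z' u ω := measurable_pi_lambda _ hz'.measurable
  -- With the past fixed at `p`, the increments can be replaced by the noise itself, and the section
  -- of `C` gets its transition probability.
  have h3 : ∀ p : ℝ × Plane, P.map W (Prod.mk p ⁻¹' C)
      = ({1} : Set ℝ).indicator (fun _ ↦ transitionKernel P b z' t p.2 B) p.1 := fun p ↦ by
    rw [hW, map_increments_modification hz' s,
      Measure.map_apply hpath (measurable_prodMk_left hCm), transitionKernel_apply hz' hb.continuous,
      Measure.map_apply (measurable_canonicalSol_apply hz' hb.continuous p.2 t) hB]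
    by_cases hp : p.1 = 1
    · simp only [hC, hp, Set.mem_singleton_iff, Set.indicator_of_mem]
      congr 1
      ext ω
      simp [hp, canonicalSol]
    · have : (fun ω (u : ℝ≥0) ↦ z' u ω) ⁻¹' (Prod.mk p ⁻¹' C) = ∅ := by
        ext ω
        simp [hC, hp]
      simp [this, hp]
  have h4 : Measurable fun p : ℝ × Plane ↦ P.map W (Prod.mk p ⁻¹' C) :=
    measurable_measure_prodMk_left hCm
  rw [h1, ← Measure.map_apply (hYm.prodMk hWm) hCm, hprod, Measure.prod_apply hCm,
    lintegral_map h4 hYm, ← lintegral_indicator hAm]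
  refine lintegral_congr fun ω ↦ ?_
  rw [h3]
  by_cases hω : ω ∈ A <;> simp [hY, hω]

/-- Chapman–Kolmogorov is the integrated Markov identity with the whole space as past event. -/
lemma isTransitionSemigroup_transitionKernel (hz' : IsCadlagModification hz z')
    (hb : LipschitzWith K b) : IsTransitionSemigroup (transitionKernel P b z') where
  markov := isMarkovKernel_transitionKernel hz' hb.continuous
  zero := by
    ext1 y
    have h1 : canonicalSol b z' y 0 = fun _ ↦ y :=
      funext fun ω ↦ flow_zero hb (hz'.cadlag ω) (hz'.zero ω) y
    rw [transitionKernel_apply hz' hb.continuous, Kernel.id_apply, h1, Measure.map_const,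
      measure_univ, one_smul]
  add s t := by
    have hm := measurable_canonicalSol_apply hz' hb.continuous
    ext y B hB
    have h1 := measure_inter_canonicalSol_add hz' hb y s t
      (@MeasurableSet.univ Ω (noiseFiltration hz s)) hB
    rw [Set.univ_inter, Measure.restrict_univ] at h1
    rw [Kernel.comp_apply' _ _ _ hB, transitionKernel_apply hz' hb.continuous,
      Measure.map_apply (hm _ _) hB, h1, transitionKernel_apply hz' hb.continuous s,
      lintegral_map (Kernel.measurable_coe _ hB) (hm _ _)]

/-- The conditional expectation is determined by integrals over past events, and these see the
process only up to null sets at the two times `s` and `s + t`; hence the property passes to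
versions. -/
lemma isMarkovProcess_of_isVersion (hz' : IsCadlagModification hz z') (hb : LipschitzWith K b)
    {x : Plane} {X : ℝ≥0 → Ω → Plane} (hX : Adapted (noiseFiltration hz) X)
    (hv : IsVersion P X (canonicalSol b z' x)) :
    IsMarkovProcess P (noiseFiltration hz) (transitionKernel P b z') x X where
  adapted := hX
  start := by
    filter_upwards [hv 0] with ω hω
    rw [hω]
    exact flow_zero hb (hz'.cadlag ω) (hz'.zero ω) x
  markov s t B hB := by
    have := isMarkovKernel_transitionKernel hz' hb.continuous t
    have hXm : ∀ r, Measurable (X r) := fun r ↦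
      (hX r).mono ((noiseFiltration hz).le r) le_rfl
    have hκ : Measurable fun y ↦ (transitionKernel P b z' t y).real B :=
      (Kernel.measurable_coe _ hB).ennreal_toReal
    have hint : Integrable (fun ω ↦ (transitionKernel P b z' t (X s ω)).real B) P := by
      refine Integrable.of_bound (hκ.comp (hXm s)).aestronglyMeasurable 1
        (Eventually.of_forall fun ω ↦ ?_)
      rw [Real.norm_of_nonneg measureReal_nonneg]
      exact measureReal_le_one
    symm
    refine ae_eq_condExp_of_forall_setIntegral_eq ((noiseFiltration hz).le s)
      ((integrable_const _).indicator (hXm _ hB)) (fun _ _ _ ↦ hint.integrableOn)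
      (fun A hA _ ↦ ?_) (hκ.comp (hX s)).stronglyMeasurable.aestronglyMeasurable
    have hAm : MeasurableSet A := (noiseFiltration hz).le s A hA
    rw [integral_indicator_const _ (hXm _ hB), smul_eq_mul, mul_one, measureReal_def,
      Measure.restrict_apply (hXm _ hB), Set.inter_comm]
    have h1 : P (A ∩ X (s + t) ⁻¹' B) = P (A ∩ canonicalSol b z' x (s + t) ⁻¹' B) := by
      refine measure_congr ?_
      filter_upwards [hv (s + t)] with ω hω
      change (ω ∈ A ∧ X (s + t) ω ∈ B) = (ω ∈ A ∧ canonicalSol b z' x (s + t) ω ∈ B)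
      rw [hω]
    rw [h1, measure_inter_canonicalSol_add hz' hb x s t hA hB]
    have h2 : ∫⁻ ω in A, transitionKernel P b z' t (canonicalSol b z' x s ω) B ∂P
        = ∫⁻ ω in A, transitionKernel P b z' t (X s ω) B ∂P := by
      refine lintegral_congr_ae (ae_restrict_of_ae ?_)
      filter_upwards [hv s] with ω hω
      rw [hω]
    rw [h2]
    refine integral_toReal ?_ (Eventually.of_forall fun ω ↦ measure_lt_top _ _)
    exact ((Kernel.measurable_coe _ hB).comp (hXm s)).aemeasurable

end

end LevySDE

end

/-! ### Assembly: every claim is transferred from the canonical solution -/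

theorem theorem2p4 {Ω : Type*} [MeasurableSpace Ω] (P : Measure Ω) [IsProbabilityMeasure P]
    (z : ℝ≥0 → Ω → ℝ) (hz : LevySDE.IsLevyProcess P z)
    (l₁ l₂ : ℝ) (hl₁ : 0 < l₁) (hl₂ : 0 < l₂)
    (F : LevySDE.Plane → LevySDE.Plane)
    (hF_bdd : ∃ C : ℝ, ∀ y, ‖F y‖ ≤ C) (hF_lip : ∃ L : ℝ≥0, LipschitzWith L F) :
    -- existence of a strong solution
    (∀ x, ∃ X, LevySDE.IsStrongSolution hz l₁ l₂ F x X) ∧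
    -- uniqueness up to modification, even without adaptedness
    (∀ x X Y, LevySDE.IsSolution P z l₁ l₂ F x X → LevySDE.IsSolution P z l₁ l₂ F x Y →
      LevySDE.IsVersion P X Y) ∧
    -- solutions are exactly the processes given by the mild formula
    (∀ x X, LevySDE.IsSolution P z l₁ l₂ F x X ↔ LevySDE.IsMildSolution P z l₁ l₂ F x X) ∧
    -- càdlàg version, solving the equation simultaneously for all times
    (∀ x X, LevySDE.IsStrongSolution hz l₁ l₂ F x X →
      ∃ Y, LevySDE.IsVersion P X Y ∧ LevySDE.IsStrongSolution hz l₁ l₂ F x Y ∧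
        (∀ ω, LevySDE.IsCadlag (fun t ↦ Y t ω)) ∧
        ∀ᵐ ω ∂P, ∀ t, LevySDE.SolvesAt z l₁ l₂ F x Y t ω) ∧
    -- Markov property, with one transition semigroup for all starting points
    (∃ κ : ℝ≥0 → Kernel LevySDE.Plane LevySDE.Plane, LevySDE.IsTransitionSemigroup κ ∧
      ∀ x X, LevySDE.IsStrongSolution hz l₁ l₂ F x X →
        LevySDE.IsMarkovProcess P (LevySDE.noiseFiltration hz) κ x X ∧
        ∀ t, P.map (X t) = κ t x) := by
  obtain ⟨K, hb⟩ := LevySDE.exists_lipschitzWith_drift l₁ l₂ hF_lip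
  obtain ⟨L, hL⟩ := hF_lip
  obtain ⟨z', hz'⟩ := LevySDE.exists_cadlag_modification hz
  refine ⟨fun x ↦ ⟨_, LevySDE.isStrongSolution_canonicalSol hz' hb x⟩,
    fun x X Y hX hY ↦ (hX.isVersion_canonicalSol hz' hb).trans
      (hY.isVersion_canonicalSol hz' hb).symm,
    fun x X ↦ ⟨fun hX ↦ ?_, fun hX ↦ ?_⟩, fun x X hX ↦ ?_,
    LevySDE.transitionKernel P (LevySDE.drift l₁ l₂ F) z',
    LevySDE.isTransitionSemigroup_transitionKernel hz' hb, fun x X hX ↦ ?_⟩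
  · exact (LevySDE.isMildSolution_canonicalSol hz' hL hb x).of_isVersion hX.measurable
      (hX.isVersion_canonicalSol hz' hb)
  · exact (LevySDE.isStrongSolution_canonicalSol hz' hb x).toIsSolution.of_isVersion hX.measurable
      (hX.isVersion_canonicalSol hz' hL hF_bdd hb)
  · refine ⟨_, hX.toIsSolution.isVersion_canonicalSol hz' hb,
      LevySDE.isStrongSolution_canonicalSol hz' hb x,
      fun ω ↦ LevySDE.isCadlag_flow hb (hz'.cadlag ω) x, ?_⟩
    filter_upwards [hz'.ae_eq] with ω hω t
    obtain ⟨h1, h2⟩ := LevySDE.solvesAt_canonicalSol hz' hb x t ω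
    refine ⟨h1, h2.trans ?_⟩
    rw [LevySDE.noise, hω, LevySDE.noise]
  · have hv := hX.toIsSolution.isVersion_canonicalSol hz' hb
    refine ⟨LevySDE.isMarkovProcess_of_isVersion hz' hb hX.adapted hv, fun t ↦ ?_⟩
    rw [LevySDE.transitionKernel_apply hz' hb.continuous]
    exact Measure.map_congr (hv t)
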